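/- **Random power law graphs.** Let $\beta>3$ and $x_{\min}>0$, and let $f(x)=(\beta-1)x_{\min}^{\beta-1}x^{-\beta}$ for $x\ge x_{\min}$ be the power law density with exponent $\beta$. Assume that its mean $\nu=\int x f(x)\,dx$ (the average degree) satisfies $\nu>1$. A random power law graph $G=(V,E)$ on $n$ vertices is obtained by drawing independent weights $p_x\sim f$, $x\in V$, and then, given the weights, joining each pair of distinct vertices $x,y$ by an edge independently with probability $\min\{p_xp_y/\sum_{z\in V}p_z,\,1\}$. **Algorithm.** Write $N_k(x)$ for the set of vertices at distance at most $k$ from $x$ and $d_x$ for the degree of $x$. ApproximatePruning takes a graph $G$, an ordering $x_1,\dots,x_n$ of $V$, a number $H$ of global landmarks and radii $l_i$. It first runs breadth-first searches with pruning from $x_1,\dots,x_H$. Then, for every $i>H$, it adds to the landmark set $L(x_i)$, together with their distances to $x_i$, all vertices $y$ with $\mathrm{dist}(x_i,y)\le l_i-1$, and all vertices $y$ with $\mathrm{dist}(x_i,y)=l_i$ that have a neighbor $z$ with $\mathrm{dist}(x_i,z)=l_i-1$ and $d_z\le d_y$. For $H=0$ only the second step takes place. The landmark sets form a *2-hop cover*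 if for all $x,y\in V$ the query $\min_{z\in L(x)\cap L(y)}\big(\mathrm{dist}(x,z)+\mathrm{dist}(z,y)\big)$ equals $\mathrm{dist}(x,y)$, where the query has the value $\infty$ if $L(x)\cap L(y)=\varnothing$ and $\mathrm{dist}(x,y)=\infty$ if $x,y$ lie in different components. **Statement.** For each $x_i\in V$ let $l_i$ be the smallest integer $l\ge 1$ such that the number of edges between $N_{l-1}(x_i)$ and $V\setminus N_{l-1}(x_i)$ is at least $\delta\sqrt n$, where $\delta=5\sqrt{\nu\log n}$; if there is no such integer, put $l_i=\infty$, that is, all vertices of the component of $x_i$ become landmarks of $x_i$. There is a constant $C$, depending only on $\beta$ and $x_{\min}$, such that with probability tending to $1$ as $n\to\infty$ the following holds: for every ordering of the vertices, with $H=0$ and the radii $l_i$, ApproximatePruning outputs a 2-hop cover of $G$, and every vertex has at most $C\sqrt n\,\log^2 n$ landmarks. -/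

import Mathlib

open MeasureTheory ProbabilityTheory Filter Topology

/-! ### Landmark labels and 2-hop covers (undirected graphs) -/

/-- A landmark labeling of `V`. Each vertex `x` holds a table whose keys are its landmarks;
`L x z = d < ⊤` means that `z` is a landmark of `x` with stored distance `d`, and `L x z = ⊤` means
that `z` is not a landmark of `x`. For an undirected graph the forward and the backward table of
a vertex are combined into a single one. -/
abbrev LandmarkLabels (V : Type*) := V → V → ℕ∞

namespace LandmarkLabels

variable {V : Type*}

/-- The set of landmarks (the keys of the table) of `x`. -/
def landmarks (L : LandmarkLabels V) (x : V) : Set V := {z | L x z ≠ ⊤}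

/-- The distance query: the minimum, over the common landmarks `z` of `x` and `y`, of the sum of
the two stored distances. It is `⊤` when there is no common landmark. -/
noncomputable def query (L : LandmarkLabels V) (x y : V) : ℕ∞ :=
  ⨅ z ∈ L.landmarks x ∩ L.landmarks y, L x z + L y z

/-- `L` is a 2-hop cover of `G`: all distance queries are answered exactly (the distance, and hence
the answer, is `⊤` for two vertices in different components). -/
def IsTwoHopCover (L : LandmarkLabels V) (G : SimpleGraph V) : Prop :=
  ∀ x y : V, L.query x y = G.edist x y

end LandmarkLabels

/-! ### The algorithm ApproximatePruning (undirected graphs) -/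

section Algorithm

variable {V : Type*}

/-- The layers of the breadth-first search with pruning from the source `s`, given the
current table `L` and the set `O` of the sources that were already processed. The value at `k`
is the pair of the set of vertices of priority exactly `k` and the set of vertices of priority at
most `k`. The neighbors of a vertex `u` of priority `k` are enqueued only if the distance estimate
between `s` and `u` from the current table is larger than `k`; otherwise they are pruned. -/
noncomputable def prunedBfsLayers (G : SimpleGraph V) (O : Set V) (s : V) (L : LandmarkLabels V) :
    ℕ → Set V × Set V
  | 0 => ({s}, {s})
  | k + 1 =>
    let F := (prunedBfsLayers G O s L k).1
    let S := (prunedBfsLayers G O s L k).2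
    let F' : Set V := {y | y ∉ S ∧ y ∉ O ∧ ∃ u ∈ F, (k : ℕ∞) < L.query s u ∧ G.Adj u y}
    (F', S ∪ F')

open Classical in
/-- The table after the breadth-first search with pruning from `s`: the entry `s → k` is added to
every vertex `u` that is found with priority `k` and is not pruned. -/
noncomputable def prunedBfs (G : SimpleGraph V) (O : Set V) (s : V) (L : LandmarkLabels V) :
    LandmarkLabels V := fun u v =>
  if v = s then
    min (L u s)
      (⨅ k ∈ {k : ℕ | u ∈ (prunedBfsLayers G O s L k).1 ∧ (k : ℕ∞) < L.query s u}, (k : ℕ∞))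
  else L u v

open Classical in
/-- The table after the breadth-first searches with pruning from the first `h` vertices of the
ordering `π`, starting from the empty table. -/
noncomputable def globalPhase {n : ℕ} (G : SimpleGraph V) (π : Fin n ≃ V) : ℕ → LandmarkLabels V
  | 0 => fun _ _ => ⊤
  | h + 1 =>
    if hh : h < n then
      prunedBfs G {v | (π.symm v : ℕ) < h} (π ⟨h, hh⟩) (globalPhase G π h)
    else globalPhase G π h

/-- The landmarks that the local search of radius `r` from `x` adds to `x`: all vertices at
distance at most `r - 1`, and those vertices `y` at distance exactly `r` that have a neighbor `z`
at distance `r - 1` from `x` whose degree is at most the degree of `y`. For `r = ⊤`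
this is the whole connected component of `x`. -/
def localLandmarks (G : SimpleGraph V) (x : V) (r : ℕ∞) : Set V :=
  {y | G.edist x y ≠ ⊤ ∧
    (G.edist x y + 1 ≤ r ∨
      (G.edist x y = r ∧ ∃ z : V, G.edist x z + 1 = r ∧ G.Adj z y ∧
        (G.neighborSet z).ncard ≤ (G.neighborSet y).ncard))}

open Classical in
/-- The output of ApproximatePruning on the undirected graph `G` with the ordering `π` of the
vertices, the number `H` of global landmarks and the radii `l`: first the searches with pruning
from the first `H` vertices, then, for every other vertex `x`, the entries `y → dist(x, y)` for the
vertices `y` found by the local search of radius `l x`. -/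
noncomputable def approximatePruning {n : ℕ} (G : SimpleGraph V) (π : Fin n ≃ V) (H : ℕ)
    (l : V → ℕ∞) : LandmarkLabels V := fun x y =>
  if H ≤ (π.symm x : ℕ) ∧ y ∈ localLandmarks G x (l x) then
    min (globalPhase G π H x y) (G.edist x y)
  else globalPhase G π H x y

/-- The ball `N_k(x)`: the vertices at distance at most `k` from `x`. -/
def closedNeighborhood (G : SimpleGraph V) (x : V) (k : ℕ) : Set V := {y | G.edist x y ≤ k}

/-- The number of edges between `N_k(x)` and its complement (each such edge is counted once, as the
pair of its endpoint inside and its endpoint outside). -/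
noncomputable def boundaryEdges (G : SimpleGraph V) (x : V) (k : ℕ) : ℕ :=
  {e : V × V | e.1 ∈ closedNeighborhood G x k ∧ e.2 ∉ closedNeighborhood G x k ∧
    G.Adj e.1 e.2}.ncard

/-- The smallest integer `l ≥ 1` such that there are at least `t` edges between `N_{l-1}(x)` and its
complement; `⊤` if there is no such integer, and then the local search exhausts the component. -/
noncomputable def localRadius (G : SimpleGraph V) (t : ℝ) (x : V) : ℕ∞ :=
  ⨅ k ∈ {k : ℕ | t ≤ (boundaryEdges G x k : ℝ)}, ((k + 1 : ℕ) : ℕ∞)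

end Algorithm

/-! ### Random power law graphs -/

/-- The probability `min {p_x p_y / vol(V), 1}` of the edge `{x, y}` in the Chung-Lu model. -/
noncomputable def chungLuProb {V : Type*} [Fintype V] (p : V → ℝ) (x y : V) : ℝ :=
  min (p x * p y / ∑ z, p z) 1

/-- The graph on `V` in which the distinct vertices `x`, `y` are adjacent if and only if the number
attached to the pair `{x, y}` is less than `min {p_x p_y / vol(V), 1}`. When these numbers are
independent and uniform in `[0, 1]`, this is the Chung-Lu random graph with weights `p`. -/
def chungLuGraph {V : Type*} [Fintype V] (p : V → ℝ) (U : Sym2 V → unitInterval) :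
    SimpleGraph V where
  Adj x y := x ≠ y ∧ (U s(x, y) : ℝ) < chungLuProb p x y
  symm := ⟨fun x y h => ⟨h.1.symm, by
    have h2 := h.2
    rwa [chungLuProb, Sym2.eq_swap, mul_comm (p x) (p y)] at h2⟩⟩
  loopless := ⟨fun _ h => h.1 rfl⟩

/-- The power law distribution with exponent `β` on `[xmin, ∞)`, with the density
`(β - 1) xmin ^ (β - 1) x ^ (-β)`: the Pareto distribution of shape `β - 1`. -/
noncomputable def powerLaw (xmin β : ℝ) : Measure ℝ := paretoMeasure xmin (β - 1)

/-- The sample space of a random power law graph on `n` vertices: the weights of the vertices, and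
a number in `[0, 1]` for each pair of vertices. -/
abbrev PowerLawSample (n : ℕ) := (Fin n → ℝ) × (Sym2 (Fin n) → unitInterval)

/-- The distribution of the sample: independent weights with the power law distribution, and
independent numbers, uniform in `[0, 1]`, that are independent of the weights. -/
noncomputable def powerLawSampleMeasure (n : ℕ) (xmin β : ℝ) : Measure (PowerLawSample n) :=
  (Measure.pi fun _ : Fin n => powerLaw xmin β).prod
    (Measure.pi fun _ : Sym2 (Fin n) => (volume : Measure unitInterval))

/-- The random power law graph: the Chung-Lu graph of the random weights. -/
def powerLawGraph {n : ℕ} (ω : PowerLawSample n) : SimpleGraph (Fin n) := chungLuGraph ω.1 ω.2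

/-! ### Independence in finite products of Boolean spaces -/

section BooleanProduct

variable {ι : Type*} [Fintype ι] (ρ : ι → Measure Bool) [∀ i, IsProbabilityMeasure (ρ i)]

/-! Two deterministic facts reduce the theorem to properties of balls and degrees; put t = δ√n.
Cover (`isTwoHopCover_of_edist_le`): let N_k(x) and N_j(y) have at least t boundary edges and
suppose dist(x,y) ≤ k + j + 1. Then a geodesic has a vertex in both balls or an edge joining their
last layers, and in the second case the degree rule makes the endpoint of larger degree a common
landmark. Size (`ncard_localLandmarks_le`): if every ball with between m and 2m vertices has at
least t boundary edges, the search stops before its ball exceeds 2m. The last layer has at most t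
vertices, and each adds only its neighbors of at least its own degree.

The random part fixes the weights and uses that breadth-first search leaves the pairs between the
last layer and the unexplored vertices untouched, hence independent of the past
(`integral_label_le`). A boundary of t edges makes the last layer weigh at least 4t/5
(`prob_boundaryEdges_ge_le`), and two disjoint balls with layers this heavy are joined by an edge
except with probability exp(-(4t/5)²/vol), which is below n⁻⁵ (`prob_separated_layers_le`).

Expansion comes from a supermartingale. Since β > 3 the second moment is finite, and the size-biased
mean E p²/ν is at least ν > 1. For small θ, η a layer of weight a therefore satisfies E exp(-θ·next
weight) ≤ exp(-θ(1+η)a) as long as the explored set is small, so exp(θη·(weight explored before the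
layer) - θ·(layer weight)) has expectation at most 1 (`integral_potential_le_one`). A ball of at
least m = √n log² n vertices with fewer than t boundary edges would make a potential of this kind
huge (`prob_small_boundary_le`).

Degrees concentrate around weights, so a vertex has O(log n) neighbors of at least its own degree,
and t·O(log n) is within √n log² n. A union bound over vertices and radii finishes the argument for
typical weights, and laws of large numbers show that the weights are typical. -/

theorem integrable_boolProduct (f : (ι → Bool) → ℝ) : Integrable f (Measure.pi ρ) :=
  Integrable.of_finite

theorem integral_mul_of_dependsOn {f g : (ι → Bool) → ℝ} {D : Set ι}
    (hf : DependsOn f D) (hg : DependsOn g Dᶜ) :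
    ∫ c, f c * g c ∂(Measure.pi ρ) = (∫ c, f c ∂(Measure.pi ρ)) * ∫ c, g c ∂(Measure.pi ρ) := by
  classical
  have hind : iIndepFun (fun (i : ι) (c : ι → Bool) => c i) (Measure.pi ρ) :=
    iIndepFun_pi (X := fun _ => id) fun i => measurable_id.aemeasurable
  have h2 := hind.indepFun_finset D.toFinset Dᶜ.toFinset
    (by rw [Set.disjoint_toFinset]; exact disjoint_compl_right) (fun i => measurable_pi_apply i)
  have hf' : DependsOn f (D.toFinset : Set ι) := by simpa using hf
  have hg' : DependsOn g (Dᶜ.toFinset : Set ι) := by simpa using hg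
  obtain ⟨f', rfl⟩ := dependsOn_iff_exists_comp.1 hf'
  obtain ⟨g', rfl⟩ := dependsOn_iff_exists_comp.1 hg'
  have h3 := h2.comp (φ := f') (ψ := g') (measurable_of_finite _) (measurable_of_finite _)
  exact h3.integral_fun_mul_eq_mul_integral (measurable_of_finite _).aestronglyMeasurable
    (measurable_of_finite _).aestronglyMeasurable

theorem DependsOn.finsetProd {ι κ : Type*} (s : Finset κ) {f : κ → (ι → Bool) → ℝ}
    {D : κ → Set ι} (hf : ∀ i ∈ s, DependsOn (f i) (D i)) :
    DependsOn (fun c => ∏ i ∈ s, f i c) (⋃ i ∈ s, D i) := by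
  intro c c' h
  refine Finset.prod_congr rfl fun i hi => hf i hi fun e he => h e ?_
  exact Set.mem_biUnion hi he

theorem integral_prod_of_dependsOn {κ : Type*} (s : Finset κ) {f : κ → (ι → Bool) → ℝ}
    {D : κ → Set ι} (hf : ∀ i ∈ s, DependsOn (f i) (D i))
    (hD : (s : Set κ).PairwiseDisjoint D) :
    ∫ c, ∏ i ∈ s, f i c ∂(Measure.pi ρ) = ∏ i ∈ s, ∫ c, f i c ∂(Measure.pi ρ) := by
  classical
  induction s using Finset.induction_on with
  | empty => simp
  | insert a s ha ih =>
    simp only [Finset.prod_insert ha]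
    rw [integral_mul_of_dependsOn ρ (hf a (Finset.mem_insert_self _ _)) (g := fun c => ∏ i ∈ s, f i c),
      ih (fun i hi => hf i (Finset.mem_insert_of_mem hi))
        (hD.subset (by simp))]
    refine (DependsOn.finsetProd s fun i hi => hf i (Finset.mem_insert_of_mem hi)).mono ?_
    refine Set.iUnion₂_subset fun i hi => ?_
    refine (Set.disjoint_left.1 (hD (Finset.mem_coe.2 (Finset.mem_insert_of_mem hi))
      (Finset.mem_coe.2 (Finset.mem_insert_self _ _)) ?_))
    rintro rfl; exact ha hi

/-- Conditioning on a label `X` whose level sets depend on coordinates that the weight attached to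
that level does not involve. -/
theorem integral_label_le {τ : Type*} [Fintype τ] (X : (ι → Bool) → τ) (D : τ → Set ι)
    (hX : ∀ t, DependsOn (fun c => X c = t) (D t)) (h : τ → (ι → Bool) → ℝ)
    (hh : ∀ t, DependsOn (h t) (D t)ᶜ) (r : τ → ℝ)
    (hr : ∀ t, ∫ c, h t c ∂(Measure.pi ρ) ≤ r t) :
    ∫ c, h (X c) c ∂(Measure.pi ρ) ≤ ∫ c, r (X c) ∂(Measure.pi ρ) := by
  classical
  -- Summing over the values of the label makes each term a product of two functions of
  -- complementary coordinates.
  have key : ∀ g : τ → (ι → Bool) → ℝ, ∀ c,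
      g (X c) c = ∑ t, (if X c = t then (1 : ℝ) else 0) * g t c := by
    intro g c; simp
  have e1 : ∫ c, h (X c) c ∂(Measure.pi ρ) =
      ∑ t, (∫ c, (if X c = t then (1 : ℝ) else 0) ∂(Measure.pi ρ)) *
        ∫ c, h t c ∂(Measure.pi ρ) := by
    simp_rw [key h]
    rw [integral_finsetSum _ fun t _ => integrable_boolProduct ρ _]
    refine Finset.sum_congr rfl fun t _ => ?_
    refine integral_mul_of_dependsOn ρ (D := D t) ?_ (hh t)
    intro c c' hc
    have := hX t hc
    simp only at this
    simp only [this]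
  have e2 : ∫ c, r (X c) ∂(Measure.pi ρ) =
      ∑ t, (∫ c, (if X c = t then (1 : ℝ) else 0) ∂(Measure.pi ρ)) * r t := by
    simp_rw [key (fun t _ => r t)]
    rw [integral_finsetSum _ fun t _ => integrable_boolProduct ρ _]
    refine Finset.sum_congr rfl fun t _ => ?_
    rw [integral_mul_const]
  rw [e1, e2]
  refine Finset.sum_le_sum fun t _ => mul_le_mul_of_nonneg_left (hr t) ?_
  exact integral_nonneg fun c => by split_ifs <;> simp

/-- Markov's inequality, in the form behind every tail bound for fixed weights. -/
theorem measureReal_le_integral_of_indicator_le {S : Set (ι → Bool)} {f : (ι → Bool) → ℝ}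
    (h0 : ∀ c, 0 ≤ f c) (h1 : ∀ c ∈ S, 1 ≤ f c) :
    (Measure.pi ρ).real S ≤ ∫ c, f c ∂(Measure.pi ρ) := by
  rw [← integral_indicator_one (Set.toFinite S).measurableSet]
  refine integral_mono (integrable_boolProduct ρ _) (integrable_boolProduct ρ _) fun c => ?_
  by_cases hc : c ∈ S
  · simpa [hc] using h1 c hc
  · simpa [hc] using h0 c

theorem integral_coordinate (i : ι) (φ : Bool → ℝ) :
    ∫ c, φ (c i) ∂(Measure.pi ρ) = (ρ i).real {true} * φ true + (ρ i).real {false} * φ false := by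
  rw [← integral_map (φ := fun c : ι → Bool => c i) (measurable_pi_apply i).aemeasurable
    (measurable_of_finite φ).aestronglyMeasurable, (measurePreserving_eval ρ i).map_eq,
    integral_fintype Integrable.of_finite]
  simp

end BooleanProduct

/-! ### The random edge set of a Chung-Lu graph -/

section EdgeMeasure

variable {V : Type*} [Fintype V]

/-- The edge probabilities as a function of unordered pairs. -/
noncomputable def edgeProb (p : V → ℝ) : Sym2 V → ℝ :=
  Sym2.lift ⟨chungLuProb p, fun x y => by rw [chungLuProb, chungLuProb, mul_comm]⟩

@[simp] theorem edgeProb_mk (p : V → ℝ) (x y : V) : edgeProb p s(x, y) = chungLuProb p x y := rfl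

theorem edgeProb_le_one (p : V → ℝ) (e : Sym2 V) : edgeProb p e ≤ 1 := by
  induction e using Sym2.inductionOn with
  | hf x y => exact min_le_right _ _

theorem edgeProb_nonneg {p : V → ℝ} (hp : ∀ x, 0 ≤ p x) (e : Sym2 V) : 0 ≤ edgeProb p e := by
  induction e using Sym2.inductionOn with
  | hf x y =>
    exact le_min (div_nonneg (mul_nonneg (hp x) (hp y)) (Finset.sum_nonneg fun z _ => hp z)) zero_le_one

/-- The law of the state of the pair `e`. -/
noncomputable def edgeLaw (p : V → ℝ) (e : Sym2 V) : Measure Bool :=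
  (volume : Measure unitInterval).map (fun u : unitInterval => decide ((u : ℝ) < edgeProb p e))

theorem measurable_edgeState (p : V → ℝ) (e : Sym2 V) :
    Measurable (fun u : unitInterval => decide ((u : ℝ) < edgeProb p e)) := by
  refine measurable_to_bool ?_
  have : (fun u : unitInterval => decide ((u : ℝ) < edgeProb p e)) ⁻¹' {true} =
      {u : unitInterval | (u : ℝ) < edgeProb p e} := by ext u; simp
  rw [this]
  exact measurableSet_lt measurable_subtype_coe measurable_const

instance (p : V → ℝ) (e : Sym2 V) : IsProbabilityMeasure (edgeLaw p e) :=
  Measure.isProbabilityMeasure_map (measurable_edgeState p e).aemeasurable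

theorem edgeLaw_true {p : V → ℝ} (hp : ∀ x, 0 ≤ p x) (e : Sym2 V) :
    (edgeLaw p e).real {true} = edgeProb p e := by
  rw [measureReal_def, edgeLaw, Measure.map_apply (measurable_edgeState p e) (by simp)]
  have : (fun u : unitInterval => decide ((u : ℝ) < edgeProb p e)) ⁻¹' {true} =
      Set.Iio (⟨edgeProb p e, edgeProb_nonneg hp e, edgeProb_le_one p e⟩ : unitInterval) := by
    ext u; simp [← Subtype.coe_lt_coe]
  rw [this, unitInterval.volume_Iio, ENNReal.toReal_ofReal (edgeProb_nonneg hp e)]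

theorem edgeLaw_false {p : V → ℝ} (hp : ∀ x, 0 ≤ p x) (e : Sym2 V) :
    (edgeLaw p e).real {false} = 1 - edgeProb p e := by
  have h := probReal_compl_eq_one_sub (μ := edgeLaw p e) (s := {true}) (by simp)
  rw [edgeLaw_true hp] at h
  rw [← h]; congr 1; ext b; cases b <;> simp

/-- The joint law of the states of all pairs. -/
noncomputable abbrev edgeMeasure (p : V → ℝ) : Measure (Sym2 V → Bool) := Measure.pi (edgeLaw p)

/-- The value `1` if the pair is an open edge and `0` otherwise. -/
def edgeInd (c : Sym2 V → Bool) (e : Sym2 V) : ℝ := if c e then 1 else 0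

/-- One formula serves two purposes: the weight e^l - 1 yields exponential moments of edge counts,
the weight -1 the probability that no pair is open. -/
theorem integral_prod_edges {p : V → ℝ} (hp : ∀ x, 0 ≤ p x) {κ : Type*} (s : Finset κ)
    (e : κ → Sym2 V) (he : Set.InjOn e s) (w : κ → ℝ) :
    ∫ c, ∏ i ∈ s, (1 + w i * edgeInd c (e i)) ∂(edgeMeasure p) =
      ∏ i ∈ s, (1 + w i * edgeProb p (e i)) := by
  rw [integral_prod_of_dependsOn (edgeLaw p) s (D := fun i => {e i})]
  · refine Finset.prod_congr rfl fun i _ => ?_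
    have := integral_coordinate (edgeLaw p) (e i) (fun b => 1 + w i * (if b then 1 else 0))
    simp only [edgeInd]
    rw [this, edgeLaw_true hp, edgeLaw_false hp]
    simp; ring
  · intro i _ c c' h
    have := h (e i) rfl
    simp only [edgeInd, this]
  · intro i hi j hj hij
    simp only [Function.onFun, Set.disjoint_singleton]
    exact fun h => hij (he hi hj h)

theorem integral_prod_edges_le {p : V → ℝ} (hp : ∀ x, 0 ≤ p x) {κ : Type*} (s : Finset κ)
    (e : κ → Sym2 V) (he : Set.InjOn e s) {w : ℝ} (hw : -1 ≤ w) :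
    ∫ c, ∏ i ∈ s, (1 + w * edgeInd c (e i)) ∂(edgeMeasure p) ≤
      Real.exp (w * ∑ i ∈ s, edgeProb p (e i)) := by
  rw [integral_prod_edges hp s e he, Finset.mul_sum, Real.exp_sum]
  refine Finset.prod_le_prod (fun i _ => ?_) fun i _ => ?_
  · nlinarith [edgeProb_nonneg hp (e i), edgeProb_le_one p (e i)]
  · linarith [Real.add_one_le_exp (w * edgeProb p (e i))]

theorem exp_mul_sum_edgeInd {V κ : Type*} (s : Finset κ) (e : κ → Sym2 V) (c : Sym2 V → Bool) (l : ℝ) :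
    Real.exp (l * ∑ i ∈ s, edgeInd c (e i)) = ∏ i ∈ s, (1 + (Real.exp l - 1) * edgeInd c (e i)) := by
  rw [Finset.mul_sum, Real.exp_sum]
  refine Finset.prod_congr rfl fun i _ => ?_
  unfold edgeInd
  split_ifs <;> simp

theorem integral_exp_sum_edgeInd_le {p : V → ℝ} (hp : ∀ x, 0 ≤ p x) {κ : Type*} (s : Finset κ)
    (e : κ → Sym2 V) (he : Set.InjOn e s) (l : ℝ) :
    ∫ c, Real.exp (l * ∑ i ∈ s, edgeInd c (e i)) ∂(edgeMeasure p) ≤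
      Real.exp ((Real.exp l - 1) * ∑ i ∈ s, edgeProb p (e i)) := by
  simp_rw [exp_mul_sum_edgeInd]
  exact integral_prod_edges_le hp s e he (by linarith [Real.exp_pos l])

/-- The probability that a set of pairs contains no edge. -/
theorem integral_prod_closed_le {p : V → ℝ} (hp : ∀ x, 0 ≤ p x) (s : Finset (V × V))
    (he : Set.InjOn (fun i : V × V => s(i.1, i.2)) s) :
    ∫ c, ∏ i ∈ s, (1 - edgeInd c s(i.1, i.2)) ∂(edgeMeasure p) ≤
      Real.exp (-∑ i ∈ s, p i.1 * p i.2 / ∑ z, p z) := by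
  have h := integral_prod_edges hp s (fun i : V × V => s(i.1, i.2)) he (fun _ => -1)
  simp only [neg_mul, one_mul, ← sub_eq_add_neg] at h
  rw [h, ← Finset.sum_neg_distrib, Real.exp_sum]
  refine Finset.prod_le_prod (fun i _ => ?_) fun i _ => ?_
  · linarith [edgeProb_le_one p s(i.1, i.2)]
  · rw [edgeProb_mk, chungLuProb]
    rcases min_choice (p i.1 * p i.2 / ∑ z, p z) 1 with h | h <;> rw [h]
    · linarith [Real.add_one_le_exp (-(p i.1 * p i.2 / ∑ z, p z))]
    -- Where the minimum is 1 the pair is surely open, so the factor is 0 and the bound survives the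
    -- truncation.
    · simpa using (Real.exp_pos _).le

end EdgeMeasure

/-! ### Distances, balls and boundaries -/

section Graph

variable {V : Type*} (G : SimpleGraph V)

/-- Both distances are bounded along a shortest walk, and the triangle inequality forces equality in
both bounds. -/
theorem exists_vertex_at_edist {x y : V} {d : ℕ} (h : G.edist x y = d) :
    ∃ f : ℕ → V, (∀ i ≤ d, G.edist x (f i) = i ∧ G.edist y (f i) = (d - i : ℕ)) ∧
      ∀ i < d, G.Adj (f i) (f (i + 1)) := by
  obtain ⟨p, hp⟩ := G.exists_walk_of_edist_eq_coe h
  refine ⟨p.getVert, fun i hi => ?_, fun i hi => p.adj_getVert_succ (by omega)⟩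
  have h1 : G.edist x (p.getVert i) ≤ i := by
    refine (p.take i).edist_le.trans ?_
    rw [SimpleGraph.Walk.take_length]; exact_mod_cast min_le_left _ _
  have h2 : G.edist y (p.getVert i) ≤ (d - i : ℕ) := by
    rw [SimpleGraph.edist_comm]
    refine (p.drop i).edist_le.trans ?_
    rw [SimpleGraph.Walk.drop_length, hp]
  have h3 := G.edist_triangle (u := x) (v := p.getVert i) (w := y)
  rw [h, SimpleGraph.edist_comm (u := p.getVert i)] at h3
  obtain ⟨a, ha⟩ := ENat.ne_top_iff_exists.1 (ne_top_of_le_ne_top (ENat.natCast_ne_top _) h1)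
  obtain ⟨b, hb⟩ := ENat.ne_top_iff_exists.1 (ne_top_of_le_ne_top (ENat.natCast_ne_top _) h2)
  rw [← ha] at h1 h3 ⊢
  rw [← hb] at h2 h3 ⊢
  norm_cast at h1 h2 h3 ⊢
  omega

theorem mem_closedNeighborhood_self (x : V) (k : ℕ) : x ∈ closedNeighborhood G x k := by
  simp [closedNeighborhood]

theorem closedNeighborhood_mono (x : V) {j k : ℕ} (h : j ≤ k) :
    closedNeighborhood G x j ⊆ closedNeighborhood G x k := fun y hy =>
  le_trans (show G.edist x y ≤ j from hy) (by exact_mod_cast h)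

theorem mem_closedNeighborhood_succ {x y : V} {k : ℕ} :
    y ∈ closedNeighborhood G x (k + 1) ↔
      y ∈ closedNeighborhood G x k ∨ ∃ v ∈ closedNeighborhood G x k, G.Adj v y := by
  constructor
  · intro hy
    have hy' : G.edist x y ≤ (k + 1 : ℕ) := hy
    obtain ⟨d, hd⟩ := ENat.ne_top_iff_exists.1 (ne_top_of_le_ne_top (ENat.natCast_ne_top _) hy')
    rw [← hd] at hy'
    have hdk : d ≤ k + 1 := by exact_mod_cast hy'
    rcases Nat.lt_or_ge d (k + 1) with h | h
    · left
      show G.edist x y ≤ k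
      rw [← hd]; exact_mod_cast Nat.lt_succ_iff.1 h
    · right
      obtain rfl : d = k + 1 := by omega
      obtain ⟨f, hf, hadj⟩ := exists_vertex_at_edist G hd.symm
      refine ⟨f k, (hf k (by omega)).1.le, ?_⟩
      have e : f (k + 1) = y := by
        have := (hf (k + 1) le_rfl).2
        simp only [Nat.sub_self, Nat.cast_zero, SimpleGraph.edist_eq_zero_iff] at this
        exact this.symm
      rw [← e]; exact hadj k (by omega)
  · rintro (h | ⟨v, hv, hvy⟩)
    · exact closedNeighborhood_mono G x (Nat.le_succ k) h
    · refine (G.edist_triangle (v := v)).trans ?_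
      rw [SimpleGraph.edist_eq_one_iff_adj.2 hvy]
      push_cast
      gcongr
      exact hv

theorem edist_le_card [Fintype V] {x y : V} (h : G.edist x y ≠ ⊤) :
    G.edist x y ≤ (Fintype.card V : ℕ) := by
  classical
  obtain ⟨p⟩ := SimpleGraph.reachable_of_edist_ne_top h
  have := p.toPath.2.length_lt
  exact (p.toPath.1.edist_le).trans (by exact_mod_cast this.le)

theorem closedNeighborhood_subset_card [Fintype V] (x : V) (k : ℕ) :
    closedNeighborhood G x k ⊆ closedNeighborhood G x (Fintype.card V) := fun _ hy =>
  edist_le_card G (ne_top_of_le_ne_top (ENat.natCast_ne_top k) hy)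

theorem ncard_closedNeighborhood_succ_sdiff_le [Finite V] (x : V) (k : ℕ) :
    (closedNeighborhood G x (k + 1) \ closedNeighborhood G x k).ncard ≤ boundaryEdges G x k := by
  have : closedNeighborhood G x (k + 1) \ closedNeighborhood G x k ⊆
      Prod.snd '' {e : V × V | e.1 ∈ closedNeighborhood G x k ∧ e.2 ∉ closedNeighborhood G x k ∧
        G.Adj e.1 e.2} := by
    rintro y ⟨hy, hy'⟩
    rcases (mem_closedNeighborhood_succ G).1 hy with h | ⟨v, hv, hvy⟩
    · exact absurd h hy'
    · exact ⟨(v, y), ⟨hv, hy', hvy⟩, rfl⟩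
  exact (Set.ncard_le_ncard this).trans (Set.ncard_image_le)

theorem ncard_closedNeighborhood_succ_le [Finite V] (x : V) (k : ℕ) :
    (closedNeighborhood G x (k + 1)).ncard ≤
      (closedNeighborhood G x k).ncard + boundaryEdges G x k := by
  have h := Set.ncard_sdiff_add_ncard_of_subset (closedNeighborhood_mono G x (Nat.le_succ k))
  have := ncard_closedNeighborhood_succ_sdiff_le G x k
  simp only [Nat.succ_eq_add_one] at h
  omega

theorem closedNeighborhood_zero (x : V) : closedNeighborhood G x 0 = {x} := by
  ext y
  have : y ∈ closedNeighborhood G x 0 ↔ G.edist x y ≤ (0 : ℕ) := Iff.rfl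
  rw [this, Nat.cast_zero, nonpos_iff_eq_zero, SimpleGraph.edist_eq_zero_iff, Set.mem_singleton_iff,
    eq_comm]

theorem localRadius_eq_top_or (t : ℝ) (x : V) :
    (localRadius G t x = ⊤ ∧ ∀ k, (boundaryEdges G x k : ℝ) < t) ∨
      ∃ k : ℕ, localRadius G t x = (k + 1 : ℕ) ∧ t ≤ boundaryEdges G x k ∧
        ∀ j < k, (boundaryEdges G x j : ℝ) < t := by
  classical
  by_cases h : ∃ k, t ≤ (boundaryEdges G x k : ℝ)
  · right
    refine ⟨Nat.find h, le_antisymm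
      (iInf₂_le (f := fun (k : ℕ) _ => ((k + 1 : ℕ) : ℕ∞)) (Nat.find h) (Nat.find_spec h)) (le_iInf₂ fun k hk => ?_),
      Nat.find_spec h, fun j hj => not_le.1 (Nat.find_min h hj)⟩
    exact_mod_cast Nat.succ_le_succ (Nat.find_min' h hk)
  · left
    push Not at h
    refine ⟨?_, h⟩
    simp only [localRadius, iInf_eq_top]
    exact fun k hk => absurd (h k) (not_lt.2 hk)

theorem one_le_localRadius (t : ℝ) (x : V) : 1 ≤ localRadius G t x :=
  le_iInf₂ fun k _ => by exact_mod_cast Nat.succ_le_succ (Nat.zero_le k)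

/-! ### The labels without global landmarks -/

open Classical in
theorem approximatePruning_zero {n : ℕ} (π : Fin n ≃ V) (l : V → ℕ∞) (x y : V) :
    approximatePruning G π 0 l x y =
      if y ∈ localLandmarks G x (l x) then G.edist x y else ⊤ := by
  simp [approximatePruning, globalPhase]

theorem landmarks_approximatePruning_zero {n : ℕ} (π : Fin n ≃ V) (l : V → ℕ∞) (x : V) :
    (approximatePruning G π 0 l).landmarks x = localLandmarks G x (l x) := by
  classical
  ext y
  simp only [LandmarkLabels.landmarks, Set.mem_ofPred_eq, approximatePruning_zero]
  split_ifs with h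
  · exact iff_of_true h.1 h
  · simpa using h

theorem edist_le_query {n : ℕ} (π : Fin n ≃ V) (l : V → ℕ∞) (x y : V) :
    G.edist x y ≤ (approximatePruning G π 0 l).query x y := by
  refine le_iInf₂ fun z hz => ?_
  rw [landmarks_approximatePruning_zero, landmarks_approximatePruning_zero] at hz
  rw [approximatePruning_zero, approximatePruning_zero, if_pos hz.1, if_pos hz.2,
    G.edist_comm (u := y)]
  exact G.edist_triangle

theorem query_le_of_mem {n : ℕ} (π : Fin n ≃ V) (l : V → ℕ∞) {x y z : V}
    (hx : z ∈ localLandmarks G x (l x)) (hy : z ∈ localLandmarks G y (l y)) :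
    (approximatePruning G π 0 l).query x y ≤ G.edist x z + G.edist y z := by
  refine (iInf₂_le z ?_).trans ?_
  · rw [landmarks_approximatePruning_zero, landmarks_approximatePruning_zero]; exact ⟨hx, hy⟩
  · rw [approximatePruning_zero, approximatePruning_zero, if_pos hx, if_pos hy]

theorem mem_localLandmarks_of_lt {x z : V} {r : ℕ∞} (h : G.edist x z ≠ ⊤)
    (h' : G.edist x z + 1 ≤ r) : z ∈ localLandmarks G x r := ⟨h, Or.inl h'⟩

/-- The labels are a 2-hop cover as soon as balls with a large edge boundary intersect or are joined
by an edge. -/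
theorem isTwoHopCover_of_edist_le {n : ℕ} (π : Fin n ≃ V) (t : ℝ)
    (h : ∀ x y : V, ∀ k j : ℕ, t ≤ boundaryEdges G x k → t ≤ boundaryEdges G y j →
      G.edist x y ≤ (k + j + 1 : ℕ)) :
    (approximatePruning G π 0 (localRadius G t)).IsTwoHopCover G := by
  intro x y
  refine le_antisymm ?_ (edist_le_query G π _ x y)
  by_cases htop : G.edist x y = ⊤
  · rw [htop]; exact le_top
  have self : ∀ z, z ∈ localLandmarks G z (localRadius G t z) := fun z =>
    mem_localLandmarks_of_lt G (by simp) (by simpa using one_le_localRadius G t z)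
  -- If one search exhausts its component, the other endpoint is itself a common landmark. Otherwise
  -- the radii are k + 1 and j + 1.
  rcases localRadius_eq_top_or G t x with ⟨hx, -⟩ | ⟨k, hx, hxk, -⟩
  · refine (query_le_of_mem G π _ (z := y) (mem_localLandmarks_of_lt G htop ?_) (self y)).trans ?_
    · rw [hx]; exact le_top
    · simp
  rcases localRadius_eq_top_or G t y with ⟨hy, -⟩ | ⟨j, hy, hyj, -⟩
  · have htop' : G.edist y x ≠ ⊤ := by rwa [G.edist_comm]
    refine (query_le_of_mem G π _ (z := x) (self x) (mem_localLandmarks_of_lt G htop' ?_)).trans ?_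
    · rw [hy]; exact le_top
    · simp [G.edist_comm]
  have hd := h x y k j hxk hyj
  obtain ⟨d, hd'⟩ := ENat.ne_top_iff_exists.1 htop
  rw [← hd'] at hd ⊢
  have hd2 : d ≤ k + j + 1 := by exact_mod_cast hd
  obtain ⟨f, hf, hadj⟩ := exists_vertex_at_edist G hd'.symm
  have done : ∀ i ≤ d, f i ∈ localLandmarks G x (localRadius G t x) →
      f i ∈ localLandmarks G y (localRadius G t y) →
      (approximatePruning G π 0 (localRadius G t)).query x y ≤ d := fun i hi h1 h2 => by
    refine (query_le_of_mem G π _ h1 h2).trans ?_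
    rw [(hf i hi).1, (hf i hi).2]
    norm_cast
    omega
  have inx : ∀ i ≤ d, i ≤ k → f i ∈ localLandmarks G x (localRadius G t x) := fun i hi hik => by
    refine mem_localLandmarks_of_lt G ?_ ?_ <;> rw [(hf i hi).1]
    · exact ENat.natCast_ne_top _
    · rw [hx]; exact_mod_cast Nat.succ_le_succ hik
  have iny : ∀ i ≤ d, d - i ≤ j → f i ∈ localLandmarks G y (localRadius G t y) :=
    fun i hi hik => by
    refine mem_localLandmarks_of_lt G ?_ ?_ <;> rw [(hf i hi).2]
    · exact ENat.natCast_ne_top _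
    · rw [hy]; exact_mod_cast Nat.succ_le_succ hik
  rcases Nat.lt_or_ge d (k + j + 1) with hlt | hge
  · rcases le_total d k with hdk | hdk
    · exact done d le_rfl (inx d le_rfl hdk) (iny d le_rfl (by omega))
    · exact done k hdk (inx k hdk le_rfl) (iny k hdk (by omega))
  · obtain rfl : d = k + j + 1 := by omega
    -- The middle edge of the geodesic joins the two last layers. Each endpoint lies in one ball and
    -- at distance exactly the radius from the other source, so the degree comparison decides which
    -- one both searches keep.
    rcases le_total (G.neighborSet (f k)).ncard (G.neighborSet (f (k + 1))).ncard with hdeg | hdeg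
    · refine done (k + 1) (by omega) ?_ (iny (k + 1) (by omega) (by omega))
      refine ⟨?_, Or.inr ⟨?_, f k, ?_, hadj k (by omega), hdeg⟩⟩
      · rw [(hf (k + 1) (by omega)).1]; exact ENat.natCast_ne_top _
      · rw [(hf (k + 1) (by omega)).1, hx]
      · rw [(hf k (by omega)).1, hx]; norm_cast
    · refine done k (by omega) (inx k (by omega) le_rfl) ?_
      refine ⟨?_, Or.inr ⟨?_, f (k + 1), ?_, (hadj k (by omega)).symm, hdeg⟩⟩
      · rw [(hf k (by omega)).2]; exact ENat.natCast_ne_top _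
      · rw [(hf k (by omega)).2, hy]; congr 1; omega
      · rw [(hf (k + 1) (by omega)).2, hy]; norm_cast; omega

/-- The number of local landmarks, if balls of intermediate size have a large edge boundary and every
vertex has few neighbors of at least its own degree. -/
theorem ncard_localLandmarks_le [Fintype V] {t m K : ℝ} (ht : 1 ≤ t) (htm : t ≤ m) (hm : 1 < m)
    (x : V)
    (hexp : ∀ k ≤ Fintype.card V, m ≤ (closedNeighborhood G x k).ncard →
      ((closedNeighborhood G x k).ncard : ℝ) ≤ 2 * m → t ≤ boundaryEdges G x k)
    (hdeg : ∀ z : V,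
      (({y | G.Adj z y ∧ (G.neighborSet z).ncard ≤ (G.neighborSet y).ncard}).ncard : ℝ) ≤ K) :
    ((localLandmarks G x (localRadius G t x)).ncard : ℝ) ≤ 2 * m + t * K := by
  classical
  have hK : 0 ≤ K := le_trans (Nat.cast_nonneg _) (hdeg x)
  have step : ∀ j, ((closedNeighborhood G x (j + 1)).ncard : ℝ) ≤
      (closedNeighborhood G x j).ncard + boundaryEdges G x j := fun j => by
    exact_mod_cast ncard_closedNeighborhood_succ_le G x j
  -- A ball gains fewer than t ≤ m vertices per step, so it cannot jump over the window [m, 2m];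
  -- inside the window its boundary would be large.
  have small : ∀ j ≤ Fintype.card V, (∀ i ≤ j, (boundaryEdges G x i : ℝ) < t) →
      ((closedNeighborhood G x j).ncard : ℝ) < m := by
    intro j
    induction j with
    | zero => intro _ _; rw [closedNeighborhood_zero]; simpa using hm
    | succ j ih =>
      intro hj hb
      by_contra hcon
      push Not at hcon
      have h1 := ih (by omega) fun i hi => hb i (by omega)
      have h2 := step j
      have h3 := hb j (by omega)
      exact absurd (hexp (j + 1) hj hcon (by linarith)) (not_le.2 (hb _ le_rfl))
  rcases localRadius_eq_top_or G t x with ⟨hx, hb⟩ | ⟨k, hx, -, hb⟩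
  · have h1 := small _ le_rfl fun i _ => hb i
    have : localLandmarks G x (localRadius G t x) ⊆ closedNeighborhood G x (Fintype.card V) :=
      fun y hy => edist_le_card G hy.1
    have h2 : ((localLandmarks G x (localRadius G t x)).ncard : ℝ) ≤
      (closedNeighborhood G x (Fintype.card V)).ncard := by exact_mod_cast Set.ncard_le_ncard this
    nlinarith
  · have hball : ((closedNeighborhood G x k).ncard : ℝ) ≤ 2 * m := by
      rcases Nat.lt_or_ge (Fintype.card V) k with hk | hk
      · have h1 := small _ le_rfl fun i hi => hb i (by omega)
        have h2 : ((closedNeighborhood G x k).ncard : ℝ) ≤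
          (closedNeighborhood G x (Fintype.card V)).ncard := by
            exact_mod_cast Set.ncard_le_ncard (closedNeighborhood_subset_card G x k)
        linarith
      · cases k with
        | zero => rw [closedNeighborhood_zero]; simp; linarith
        | succ j =>
          have h1 := small j (by omega) fun i hi => hb i (by omega)
          linarith [step j, hb j (by omega)]
    -- The last layer of the ball of radius k, which is the search radius minus 1. Landmarks beyond
    -- that ball are neighbors of `S` of at least the same degree, and `S` has at most t vertices
    -- because the previous boundary had fewer than t edges.
    set S : Finset V := Finset.univ.filter fun z => G.edist x z = k with hS
    have hfront : (S.card : ℝ) ≤ t := by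
      cases k with
      | zero =>
        have : S = {x} := by ext z; simp [hS, eq_comm (a := z)]
        rw [this]; simpa using ht
      | succ j =>
        have h1 : (S : Set V) ⊆ closedNeighborhood G x (j + 1) \ closedNeighborhood G x j := by
          intro z hz
          have hz' : G.edist x z = (j + 1 : ℕ) := by simpa [hS] using hz
          refine ⟨hz'.le, fun hc => ?_⟩
          have hc' : G.edist x z ≤ j := hc
          rw [hz'] at hc'
          norm_cast at hc'
          omega
        have h2 := Set.ncard_le_ncard h1
        rw [Set.ncard_coe_finset] at h2
        have h3 := h2.trans (ncard_closedNeighborhood_succ_sdiff_le G x j)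
        have h4 : (S.card : ℝ) ≤ boundaryEdges G x j := by exact_mod_cast h3
        linarith [hb j (by omega)]
    set A : V → Set V := fun z =>
      {y | G.Adj z y ∧ (G.neighborSet z).ncard ≤ (G.neighborSet y).ncard}
    have hsub : localLandmarks G x (localRadius G t x) ⊆
        closedNeighborhood G x k ∪ ⋃ z ∈ S, A z := by
      rintro y ⟨hy, h | ⟨h1, z, hz, hzy, hle⟩⟩
      · left
        rw [hx] at h
        push_cast at h
        exact (ENat.add_le_add_iff_right (by simp)).1 h
      · right
        refine Set.mem_biUnion (x := z) ?_ ⟨hzy, hle⟩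
        rw [hx] at hz
        push_cast at hz
        simpa [hS] using hz
    have h1 := (Set.ncard_le_ncard hsub).trans (Set.ncard_union_le _ _)
    have h2 := Finset.set_ncard_biUnion_le S A
    have h3 : ((∑ z ∈ S, (A z).ncard : ℕ) : ℝ) ≤ t * K := by
      push_cast
      calc ∑ z ∈ S, ((A z).ncard : ℝ) ≤ ∑ z ∈ S, K := Finset.sum_le_sum fun z _ => hdeg z
        _ = S.card * K := by simp
        _ ≤ t * K := by gcongr
    have h4 : ((localLandmarks G x (localRadius G t x)).ncard : ℝ) ≤
        (closedNeighborhood G x k).ncard + (∑ z ∈ S, (A z).ncard : ℕ) := by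
      exact_mod_cast h1.trans (by gcongr)
    linarith

end Graph

/-! ### Breadth-first exploration as a function of the states of the pairs -/

section Exploration

variable {V : Type*}

/-- The graph whose edges are the open pairs. -/
def configGraph (c : Sym2 V → Bool) : SimpleGraph V where
  Adj x y := x ≠ y ∧ c s(x, y) = true
  symm := ⟨fun x y h => ⟨h.1.symm, by rw [Sym2.eq_swap]; exact h.2⟩⟩
  loopless := ⟨fun _ h => h.1 rfl⟩

/-- The pairs that meet the set `S`. -/
def pairsMeeting (S : Finset V) : Set (Sym2 V) := {e | ∃ v ∈ S, v ∈ e}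

theorem mk_mem_pairsMeeting {S : Finset V} {x y : V} :
    s(x, y) ∈ pairsMeeting S ↔ x ∈ S ∨ y ∈ S := by
  constructor
  · rintro ⟨v, hv, h⟩
    rcases Sym2.mem_iff.1 h with rfl | rfl
    · exact Or.inl hv
    · exact Or.inr hv
  · rintro (h | h)
    · exact ⟨x, h, Sym2.mem_mk_left x y⟩
    · exact ⟨y, h, Sym2.mem_mk_right x y⟩

variable [Fintype V] [DecidableEq V]

/-- The vertices at distance less than `k` from `x`. -/
def explored (c : Sym2 V → Bool) (x : V) : ℕ → Finset V
  | 0 => ∅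
  | k + 1 => insert x (explored c x k ∪
      Finset.univ.filter fun y => ∃ v ∈ explored c x k, c s(v, y) = true)

/-- The vertices at distance exactly `k` from `x`. -/
def bfsLayer (c : Sym2 V → Bool) (x : V) (k : ℕ) : Finset V :=
  explored c x (k + 1) \ explored c x k

theorem explored_subset_succ (c : Sym2 V → Bool) (x : V) (k : ℕ) :
    explored c x k ⊆ explored c x (k + 1) := by
  rw [explored]
  exact Finset.subset_union_left.trans (Finset.subset_insert _ _)

theorem explored_mono (c : Sym2 V → Bool) (x : V) : Monotone (explored c x) :=
  monotone_nat_of_le_succ (explored_subset_succ c x)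

theorem mem_explored_succ {c : Sym2 V → Bool} {x y : V} {k : ℕ} :
    y ∈ explored c x (k + 1) ↔
      y = x ∨ y ∈ explored c x k ∨ ∃ v ∈ explored c x k, c s(v, y) = true := by
  rw [explored]; simp

theorem coe_explored_succ (c : Sym2 V → Bool) (x : V) (k : ℕ) :
    (explored c x (k + 1) : Set V) = closedNeighborhood (configGraph c) x k := by
  induction k with
  | zero =>
    rw [closedNeighborhood_zero]; ext y
    rw [Finset.mem_coe, mem_explored_succ]; simp [explored]
  | succ k ih =>
    ext y
    rw [Finset.mem_coe, mem_explored_succ, mem_closedNeighborhood_succ, ← ih]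
    constructor
    · rintro (rfl | h | ⟨v, hv, h⟩)
      · left; rw [ih]; exact mem_closedNeighborhood_self _ _ _
      · exact Or.inl h
      -- States of loops are sampled too but are not edges; an open loop reaches only a vertex
      -- already explored.
      · by_cases hvy : v = y
        · left; rw [← hvy]; exact hv
        · exact Or.inr ⟨v, hv, hvy, h⟩
    · rintro (h | ⟨v, hv, -, h⟩)
      · exact Or.inr (Or.inl h)
      · exact Or.inr (Or.inr ⟨v, hv, h⟩)

/-- Vertices outside the next ball see the current ball only from its last layer. -/
theorem not_open_of_mem_explored {c : Sym2 V → Bool} {x v y : V} {k : ℕ} (hv : v ∈ explored c x k)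
    (hy : y ∉ explored c x (k + 1)) : c s(v, y) = false := by
  by_contra h
  exact hy (mem_explored_succ.2 (Or.inr (Or.inr ⟨v, hv, by simpa using h⟩)))

theorem explored_congr {c c' : Sym2 V → Bool} {x : V} {k : ℕ}
    (h : ∀ e ∈ pairsMeeting (explored c x k), c e = c' e) :
    ∀ j ≤ k + 1, explored c x j = explored c' x j := by
  intro j
  induction j with
  | zero => intro _; rfl
  | succ j ih =>
    intro hj
    have ih' := ih (by omega)
    ext y
    rw [mem_explored_succ, mem_explored_succ, ← ih']
    have : ∀ v ∈ explored c x j, c s(v, y) = c' s(v, y) := fun v hv =>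
      h _ (mk_mem_pairsMeeting.2 (Or.inl (explored_mono c x (by omega : j ≤ k) hv)))
    grind

theorem explored_pair_eq_iff {c c' : Sym2 V → Bool} {x : V} {k : ℕ} {t : Finset V × Finset V}
    (h : ∀ e ∈ pairsMeeting t.1, c e = c' e) (ht : (explored c x k, explored c x (k + 1)) = t) :
    (explored c' x k, explored c' x (k + 1)) = t := by
  subst ht
  rw [explored_congr h k (by omega), explored_congr h (k + 1) le_rfl]

/-- Running the search up to `explored c x (k + 1)` inspects only pairs meeting `explored c x k`.
Pairs from the last layer outwards stay fresh. -/
theorem dependsOn_explored_pair (x : V) (k : ℕ) (t : Finset V × Finset V) :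
    DependsOn (fun c : Sym2 V → Bool => (explored c x k, explored c x (k + 1)) = t)
      (pairsMeeting t.1) := fun _ _ h =>
  propext ⟨explored_pair_eq_iff h, explored_pair_eq_iff fun e he => (h e he).symm⟩

theorem dependsOn_explored_pair_pair (x y : V) (k j : ℕ)
    (t : (Finset V × Finset V) × (Finset V × Finset V)) :
    DependsOn (fun c : Sym2 V → Bool =>
      ((explored c x k, explored c x (k + 1)), (explored c y j, explored c y (j + 1))) = t)
      (pairsMeeting t.1.1 ∪ pairsMeeting t.2.1) := by
  intro c c' h
  have h1 := dependsOn_explored_pair x k t.1 fun e he => h e (Or.inl he)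
  have h2 := dependsOn_explored_pair y j t.2 fun e he => h e (Or.inr he)
  have split : ∀ a b : Finset V × Finset V, ((a, b) = t) = (a = t.1 ∧ b = t.2) := fun a b => by
    rw [Prod.ext_iff]
  simp only [split]
  exact congrArg₂ And h1 h2

theorem mem_bfsLayer_succ {c : Sym2 V → Bool} {x y : V} {k : ℕ} :
    y ∈ bfsLayer c x (k + 1) ↔
      y ∉ explored c x (k + 1) ∧ ∃ v ∈ bfsLayer c x k, c s(v, y) = true := by
  rw [bfsLayer, Finset.mem_sdiff, mem_explored_succ (k := k + 1)]
  constructor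
  · rintro ⟨rfl | h | ⟨v, hv, h⟩, hy⟩
    · exact absurd (mem_explored_succ.2 (Or.inl rfl)) hy
    · exact absurd h hy
    · refine ⟨hy, v, Finset.mem_sdiff.2 ⟨hv, fun hv' => ?_⟩, h⟩
      rw [not_open_of_mem_explored hv' hy] at h
      exact absurd h (by simp)
  · rintro ⟨hy, v, hv, h⟩
    exact ⟨Or.inr (Or.inr ⟨v, (Finset.mem_sdiff.1 hv).1, h⟩), hy⟩

/-- The edge boundary of a ball, counted by the states of the pairs. -/
theorem boundaryEdges_configGraph (c : Sym2 V → Bool) (x : V) (k : ℕ) :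
    (boundaryEdges (configGraph c) x k : ℝ) =
      ∑ i ∈ bfsLayer c x k ×ˢ (explored c x (k + 1))ᶜ, edgeInd c s(i.1, i.2) := by
  have h : {e : V × V | e.1 ∈ closedNeighborhood (configGraph c) x k ∧
      e.2 ∉ closedNeighborhood (configGraph c) x k ∧ (configGraph c).Adj e.1 e.2} =
      ((bfsLayer c x k ×ˢ (explored c x (k + 1))ᶜ).filter fun i => c s(i.1, i.2) = true :
        Finset (V × V)) := by
    ext ⟨v, y⟩
    rw [← coe_explored_succ]
    simp only [Finset.coe_filter, Finset.mem_product, Finset.mem_compl, Set.mem_ofPred_eq,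
      Finset.mem_coe]
    constructor
    · rintro ⟨h1, h2, h3⟩
      refine ⟨⟨Finset.mem_sdiff.2 ⟨h1, fun hv => ?_⟩, h2⟩, h3.2⟩
      have := h3.2
      rw [not_open_of_mem_explored hv h2] at this
      exact absurd this (by simp)
    · rintro ⟨⟨h1, h2⟩, h3⟩
      have h1' := (Finset.mem_sdiff.1 h1).1
      exact ⟨h1', h2, fun e => h2 (e ▸ h1'), h3⟩
  rw [boundaryEdges, h, Set.ncard_coe_finset, Finset.card_filter]
  push_cast
  rfl

theorem card_explored_succ (c : Sym2 V → Bool) (x : V) (k : ℕ) :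
    (explored c x (k + 1)).card = (closedNeighborhood (configGraph c) x k).ncard := by
  rw [← coe_explored_succ, Set.ncard_coe_finset]

theorem card_bfsLayer_succ_le (c : Sym2 V → Bool) (x : V) (k : ℕ) :
    (bfsLayer c x (k + 1)).card ≤ boundaryEdges (configGraph c) x k := by
  have := ncard_closedNeighborhood_succ_sdiff_le (configGraph c) x k
  rwa [← coe_explored_succ, ← coe_explored_succ, ← Finset.coe_sdiff, Set.ncard_coe_finset] at this

theorem sum_explored_succ (c : Sym2 V → Bool) (x : V) (k : ℕ) (p : V → ℝ) :
    ∑ v ∈ explored c x (k + 1), p v = ∑ v ∈ explored c x k, p v + ∑ v ∈ bfsLayer c x k, p v := by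
  rw [bfsLayer, add_comm (∑ v ∈ explored c x k, p v), Finset.sum_sdiff (explored_subset_succ c x k)]

end Exploration

/-! ### Estimates for given weights -/

section FixedWeights

variable {V : Type*} [Fintype V] [DecidableEq V]

theorem injOn_mk_of_disjoint {V : Type*} {A B : Finset V} (h : Disjoint A B) :
    Set.InjOn (fun i : V × V => s(i.1, i.2)) (A ×ˢ B : Finset (V × V)) := by
  rintro ⟨a, b⟩ h1 ⟨a', b'⟩ h2 e
  simp only [Finset.coe_product, Set.mem_prod, Finset.mem_coe] at h1 h2
  simp only [Sym2.eq_iff] at e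
  rcases e with ⟨rfl, rfl⟩ | ⟨rfl, rfl⟩
  · rfl
  · exact absurd h2.2 (Finset.disjoint_left.1 h h1.1)

theorem edgeProb_mk_le {V : Type*} [Fintype V] (p : V → ℝ) (x y : V) :
    edgeProb p s(x, y) ≤ p x * p y / ∑ z, p z := min_le_left _ _

theorem sum_mul_div_le {V : Type*} [Fintype V] {p : V → ℝ} (hp : ∀ x, 0 < p x) {a : ℝ} (ha : 0 ≤ a) (B : Finset V) :
    ∑ y ∈ B, a * p y / ∑ z, p z ≤ a := by
  have h1 : ∑ y ∈ B, p y ≤ ∑ z, p z :=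
    Finset.sum_le_sum_of_subset_of_nonneg (Finset.subset_univ _) fun z _ _ => (hp z).le
  rw [← Finset.sum_div, ← Finset.mul_sum]
  exact div_le_of_le_mul₀ (Finset.sum_nonneg fun z _ => (hp z).le) ha
    (mul_le_mul_of_nonneg_left h1 ha)

theorem sum_edgeProb_product_le {V : Type*} [Fintype V] {p : V → ℝ} (hp : ∀ x, 0 < p x) (A B : Finset V) :
    ∑ i ∈ A ×ˢ B, edgeProb p s(i.1, i.2) ≤ ∑ v ∈ A, p v := by
  rw [Finset.sum_product]
  refine Finset.sum_le_sum fun v _ => ?_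
  exact (Finset.sum_le_sum fun y _ => edgeProb_mk_le p v y).trans
    (sum_mul_div_le hp (hp v).le B)

theorem dependsOn_edges_product {V : Type*} [DecidableEq V] {S A B : Finset V}
    (hA : Disjoint A S) (hB : Disjoint B S) {c c' : Sym2 V → Bool}
    (h : ∀ e ∈ (pairsMeeting S)ᶜ, c e = c' e) {v y : V} (hv : v ∈ A) (hy : y ∈ B) :
    c s(v, y) = c' s(v, y) := by
  refine h _ fun hmem => ?_
  rcases mk_mem_pairsMeeting.1 hmem with h1 | h1
  · exact Finset.disjoint_left.1 hA hv h1
  · exact Finset.disjoint_left.1 hB hy h1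

/-- Chernoff bound: given the exploration, the boundary edges are independent with total mean at
most the weight of the layer, so many of them require a heavy layer. -/
theorem prob_boundaryEdges_ge_le {p : V → ℝ} (hp : ∀ x, 0 < p x) (x : V) (k : ℕ) {l t s : ℝ}
    (hl : 0 ≤ l) :
    (edgeMeasure p).real {c | t ≤ boundaryEdges (configGraph c) x k ∧
      ∑ v ∈ bfsLayer c x k, p v ≤ s} ≤ Real.exp ((Real.exp l - 1) * s - l * t) := by
  have hl1 : 0 ≤ Real.exp l - 1 := by linarith [Real.add_one_le_exp l]
  let X : (Sym2 V → Bool) → Finset V × Finset V := fun c => (explored c x k, explored c x (k + 1))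
  -- The second factor normalizes the conditional exponential moment to at most 1. Using t.1 ∪ t.2
  -- keeps the pairs fresh for every value t, including those with t.1 not contained in t.2.
  let h : Finset V × Finset V → (Sym2 V → Bool) → ℝ := fun t c =>
    Real.exp (l * ∑ i ∈ (t.2 \ t.1) ×ˢ (t.1 ∪ t.2)ᶜ, edgeInd c s(i.1, i.2)) *
      Real.exp (-((Real.exp l - 1) * ∑ v ∈ t.2 \ t.1, p v))
  have hdisj : ∀ t : Finset V × Finset V, Disjoint (t.2 \ t.1) (t.1 ∪ t.2)ᶜ := fun t =>
    disjoint_compl_right.mono_left (Finset.sdiff_subset.trans Finset.subset_union_right)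
  have key := integral_label_le (edgeLaw p) X (fun t => pairsMeeting t.1)
    (dependsOn_explored_pair x k) h (fun t c c' hc => ?_) (fun _ => 1) (fun t => ?_)
  · have hbound : ∀ c, h (X c) c = Real.exp (l * boundaryEdges (configGraph c) x k -
        (Real.exp l - 1) * ∑ v ∈ bfsLayer c x k, p v) := fun c => by
      simp only [h, X]
      rw [Finset.union_eq_right.2 (explored_subset_succ c x k), ← Real.exp_add,
        boundaryEdges_configGraph]
      rfl
    refine (measureReal_le_integral_of_indicator_le (edgeLaw p)
      (f := fun c => Real.exp ((Real.exp l - 1) * s - l * t) * h (X c) c)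
      (fun c => by positivity) fun c hc => ?_).trans ?_
    · rw [hbound, ← Real.exp_add]
      refine Real.one_le_exp ?_
      have h1 := mul_le_mul_of_nonneg_left hc.1 hl
      have h2 := mul_le_mul_of_nonneg_left hc.2 hl1
      linarith
    · rw [integral_const_mul]
      refine mul_le_of_le_one_right (Real.exp_pos _).le (key.trans ?_)
      simp
  · simp only [h]
    congr 3
    refine Finset.sum_congr rfl fun i hi => ?_
    rw [Finset.mem_product] at hi
    unfold edgeInd
    rw [dependsOn_edges_product Finset.sdiff_disjoint
      (disjoint_compl_left.mono_right Finset.subset_union_left) hc hi.1 hi.2]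
  · simp only [h]
    rw [integral_mul_const]
    refine (mul_le_mul_of_nonneg_right (integral_exp_sum_edgeInd_le (fun z => (hp z).le) _
      (fun i : V × V => s(i.1, i.2)) (injOn_mk_of_disjoint (hdisj t)) l) (Real.exp_pos _).le).trans ?_
    rw [← Real.exp_add, Real.exp_le_one_iff]
    have := mul_le_mul_of_nonneg_left (sum_edgeProb_product_le hp (t.2 \ t.1) (t.1 ∪ t.2)ᶜ) hl1
    linarith

theorem sum_product_mul_div {V : Type*} [Fintype V] {p : V → ℝ} (A B : Finset V) :
    ∑ i ∈ A ×ˢ B, p i.1 * p i.2 / ∑ z, p z = (∑ v ∈ A, p v) * (∑ y ∈ B, p y) / ∑ z, p z := by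
  rw [Finset.sum_product, Finset.sum_mul_sum, Finset.sum_div]
  simp_rw [Finset.sum_div]

/-- Two heavy layers of disjoint balls are unlikely to be without an edge between them. -/
theorem prob_separated_layers_le {p : V → ℝ} (hp : ∀ x, 0 < p x) (x y : V) (k j : ℕ) {s : ℝ}
    (hs : 0 ≤ s) :
    (edgeMeasure p).real {c | s ≤ ∑ v ∈ bfsLayer c x k, p v ∧ s ≤ ∑ v ∈ bfsLayer c y j, p v ∧
      Disjoint (explored c x (k + 1)) (explored c y (j + 1)) ∧
      ∀ v ∈ bfsLayer c x k, ∀ w ∈ bfsLayer c y j, c s(v, w) = false} ≤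
      Real.exp (-(s ^ 2 / ∑ z, p z)) := by
  classical
  have hvol : 0 ≤ ∑ z, p z := Finset.sum_nonneg fun z _ => (hp z).le
  let X : (Sym2 V → Bool) → (Finset V × Finset V) × (Finset V × Finset V) := fun c =>
    ((explored c x k, explored c x (k + 1)), (explored c y j, explored c y (j + 1)))
  let h : (Finset V × Finset V) × (Finset V × Finset V) → (Sym2 V → Bool) → ℝ := fun t c =>
    if Disjoint (t.1.1 ∪ t.1.2) (t.2.1 ∪ t.2.2) ∧ s ≤ ∑ v ∈ t.1.2 \ t.1.1, p v ∧
      s ≤ ∑ v ∈ t.2.2 \ t.2.1, p v then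
      ∏ i ∈ (t.1.2 \ t.1.1) ×ˢ (t.2.2 \ t.2.1), (1 - edgeInd c s(i.1, i.2)) else 0
  have hnonneg : ∀ t c, 0 ≤ h t c := fun t c => by
    simp only [h]
    split_ifs
    · refine Finset.prod_nonneg fun i _ => ?_
      unfold edgeInd; split_ifs <;> simp
    · exact le_rfl
  have key := integral_label_le (edgeLaw p) X (fun t => pairsMeeting t.1.1 ∪ pairsMeeting t.2.1)
    (dependsOn_explored_pair_pair x y k j) h (fun t c c' hc => ?_)
    (fun _ => Real.exp (-(s ^ 2 / ∑ z, p z))) (fun t => ?_)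
  · refine (measureReal_le_integral_of_indicator_le (edgeLaw p) (f := fun c => h (X c) c)
      (fun c => hnonneg _ _) fun c hc => ?_).trans (key.trans (by simp))
    obtain ⟨h1, h2, h3, h4⟩ := hc
    simp only [h, X]
    rw [Finset.union_eq_right.2 (explored_subset_succ c x k),
      Finset.union_eq_right.2 (explored_subset_succ c y j), if_pos ⟨h3, h1, h2⟩,
      Finset.prod_eq_one]
    intro i hi
    rw [Finset.mem_product] at hi
    simp [edgeInd, h4 i.1 hi.1 i.2 hi.2]
  · simp only [h]
    split_ifs with hgood
    · refine Finset.prod_congr rfl fun i hi => ?_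
      rw [Finset.mem_product] at hi
      have d1 := hgood.1
      -- A pair between the layers meets neither inner ball: each layer avoids its own inner ball,
      -- and the balls are disjoint.
      have : c s(i.1, i.2) = c' s(i.1, i.2) := by
        refine hc _ fun hmem => ?_
        have a1 := Finset.mem_sdiff.1 hi.1
        have a2 := Finset.mem_sdiff.1 hi.2
        have b1 := Finset.disjoint_left.1 d1 (Finset.mem_union_right t.1.1 a1.1)
        have b2 := Finset.disjoint_right.1 d1 (Finset.mem_union_right t.2.1 a2.1)
        rw [Finset.mem_union, not_or] at b1 b2
        rcases hmem with hm | hm <;> rcases mk_mem_pairsMeeting.1 hm with hm | hm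
        · exact a1.2 hm
        · exact b2.1 hm
        · exact b1.1 hm
        · exact a2.2 hm
      simp only [edgeInd, this]
    · rfl
  · simp only [h]
    by_cases hgood : Disjoint (t.1.1 ∪ t.1.2) (t.2.1 ∪ t.2.2) ∧ s ≤ ∑ v ∈ t.1.2 \ t.1.1, p v ∧
      s ≤ ∑ v ∈ t.2.2 \ t.2.1, p v
    · simp only [if_pos hgood]
      have hd : Disjoint (t.1.2 \ t.1.1) (t.2.2 \ t.2.1) := hgood.1.mono
        (Finset.sdiff_subset.trans Finset.subset_union_right)
        (Finset.sdiff_subset.trans Finset.subset_union_right)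
      refine (integral_prod_closed_le (fun z => (hp z).le) _ (injOn_mk_of_disjoint hd)).trans ?_
      rw [sum_product_mul_div]
      gcongr
      nlinarith [hgood.2.1, hgood.2.2]
    · simp only [if_neg hgood]
      simpa using (Real.exp_pos _).le

theorem sub_sq_half_le_one_sub_exp_neg {s : ℝ} (hs : 0 ≤ s) :
    s - s ^ 2 / 2 ≤ 1 - Real.exp (-s) := by
  have h1 := Real.quadratic_le_exp_of_nonneg hs
  have h2 : Real.exp (-s) * Real.exp s = 1 := by rw [← Real.exp_add]; simp
  -- The product (1 - s + s²/2)(1 + s + s²/2) equals 1 + s⁴/4.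
  have h3 : 1 ≤ (1 - s + s ^ 2 / 2) * Real.exp s := by
    have : 0 ≤ 1 - s + s ^ 2 / 2 := by nlinarith [sq_nonneg (s - 1)]
    calc (1 : ℝ) ≤ (1 - s + s ^ 2 / 2) * (1 + s + s ^ 2 / 2) := by nlinarith [sq_nonneg (s ^ 2)]
      _ ≤ _ := mul_le_mul_of_nonneg_left h1 this
  have := le_of_mul_le_mul_right (h2.trans_le h3) (Real.exp_pos s)
  linarith

/-- The vertices of `B` that have an open pair with a vertex of `A`. -/
def reachedFrom (c : Sym2 V → Bool) (A B : Finset V) : Finset V :=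
  B.filter fun y => ∃ v ∈ A, c s(v, y) = true

/-- Different y in B are reached through disjoint sets of pairs, so the expectation factorizes. One
factor is e^{-w} + (1 - e^{-w})·P(y not reached), estimated by 1 + u ≤ e^u. -/
theorem integral_exp_neg_sum_reachedFrom_le {V : Type*} [Fintype V] {p : V → ℝ} (hp : ∀ x, 0 < p x) {A B : Finset V}
    (hAB : Disjoint A B) {w : V → ℝ} (hw : ∀ y, 0 ≤ w y) :
    ∫ c, Real.exp (-∑ y ∈ reachedFrom c A B, w y) ∂(edgeMeasure p) ≤
      Real.exp (-∑ y ∈ B, (1 - Real.exp (-w y)) *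
        (1 - Real.exp (-((∑ v ∈ A, p v) * p y / ∑ z, p z)))) := by
  classical
  let f : V → (Sym2 V → Bool) → ℝ := fun y c =>
    Real.exp (-w y) + (1 - Real.exp (-w y)) * ∏ i ∈ A ×ˢ {y}, (1 - edgeInd c s(i.1, i.2))
  have hf : ∀ c, Real.exp (-∑ y ∈ reachedFrom c A B, w y) = ∏ y ∈ B, f y c := fun c => by
    rw [← Finset.sum_neg_distrib, Real.exp_sum, reachedFrom, Finset.prod_filter]
    refine Finset.prod_congr rfl fun y _ => ?_
    simp only [f]
    split_ifs with h
    · obtain ⟨v, hv, hvy⟩ := h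
      rw [Finset.prod_eq_zero (i := (v, y))]
      · simp
      · simpa using hv
      · simp [edgeInd, hvy]
    · push Not at h
      rw [Finset.prod_eq_one]
      · simp
      · rintro ⟨v, z⟩ hi
        simp only [Finset.mem_product, Finset.mem_singleton] at hi
        obtain ⟨hv, rfl⟩ := hi
        simp [edgeInd, h v hv]
  simp_rw [hf]
  rw [integral_prod_of_dependsOn (edgeLaw p) B (D := fun y => {e | ∃ v ∈ A, e = s(v, y)}),
    ← Finset.sum_neg_distrib, Real.exp_sum]
  · refine Finset.prod_le_prod (fun y _ => integral_nonneg fun c => ?_) fun y hy => ?_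
    · have h1 : Real.exp (-w y) ≤ 1 := by simpa using hw y
      have h2 : 0 ≤ ∏ i ∈ A ×ˢ {y}, (1 - edgeInd c s(i.1, i.2)) :=
        Finset.prod_nonneg fun i _ => by unfold edgeInd; split_ifs <;> simp
      have := Real.exp_pos (-w y)
      simp only [f, Pi.zero_apply]
      nlinarith
    · simp only [f]
      rw [integral_add (integrable_boolProduct _ _) (integrable_boolProduct _ _),
        integral_const_mul]
      have h1 : Real.exp (-w y) ≤ 1 := by simpa using hw y
      have h2 := integral_prod_closed_le (p := p) (fun z => (hp z).le) (A ×ˢ {y})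
        (injOn_mk_of_disjoint (hAB.mono_right (Finset.singleton_subset_iff.2 hy)))
      rw [sum_product_mul_div, Finset.sum_singleton] at h2
      have h3 := mul_le_mul_of_nonneg_left h2 (sub_nonneg.2 h1)
      simp only [integral_const, probReal_univ, one_smul]
      refine le_trans ?_ (Real.add_one_le_exp _)
      linarith
  · intro y _ c c' h
    simp only [f]
    congr 2
    refine Finset.prod_congr rfl fun i hi => ?_
    simp only [Finset.mem_product, Finset.mem_singleton] at hi
    unfold edgeInd
    rw [h s(i.1, i.2) ⟨i.1, hi.1, by rw [hi.2]⟩]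
  · intro y hy y' hy' hne
    refine Set.disjoint_left.2 ?_
    rintro e ⟨v, hv, rfl⟩ ⟨v', hv', e'⟩
    rcases Sym2.eq_iff.1 e' with ⟨-, h⟩ | ⟨h, -⟩
    · exact hne h
    · exact Finset.disjoint_left.1 hAB hv (h ▸ hy')

/-- If `A` is a small set inside the complement of `B` then the exponential moment of the weight
that is reached from `A` in `B` is nearly as small as with all vertices present. -/
theorem integral_exp_neg_sum_reachedFrom_le_of_small {p : V → ℝ} (hp : ∀ x, 0 < p x)
    {A B : Finset V} (hAB : Disjoint A B) {w : V → ℝ} (hw : ∀ y, 0 ≤ w y) {γ ε : ℝ}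
    (hγ : (γ + ε) * ∑ z, p z ≤ ∑ y, (1 - Real.exp (-w y)) * p y)
    (hε : (∑ z ∈ Bᶜ, p z) + (∑ z ∈ A, p z) * (∑ z, p z ^ 2) / (2 * ∑ z, p z) ≤ ε * ∑ z, p z) :
    ∫ c, Real.exp (-∑ y ∈ reachedFrom c A B, w y) ∂(edgeMeasure p) ≤
      Real.exp (-(γ * ∑ v ∈ A, p v)) := by
  refine (integral_exp_neg_sum_reachedFrom_le hp hAB hw).trans ?_
  rw [Real.exp_le_exp, neg_le_neg_iff]
  rcases A.eq_empty_or_nonempty with rfl | ⟨v0, _⟩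
  · simp
  have hvol : 0 < ∑ z, p z := Finset.sum_pos (fun z _ => hp z) ⟨v0, Finset.mem_univ _⟩
  set a := ∑ v ∈ A, p v with ha
  have ha0 : 0 ≤ a := Finset.sum_nonneg fun z _ => (hp z).le
  set S := ∑ z, p z with hS
  -- Linearizing 1 - e^{-s} costs a second-order term, and dropping the vertices outside B costs
  -- their weight. The hypothesis `hε` absorbs both losses.
  have hterm : ∀ y, (a / S) * ((1 - Real.exp (-w y)) * p y) - a ^ 2 / (2 * S ^ 2) * p y ^ 2 ≤
      (1 - Real.exp (-w y)) * (1 - Real.exp (-(a * p y / S))) := fun y => by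
    have h1 := sub_sq_half_le_one_sub_exp_neg (s := a * p y / S) (by have := hp y; positivity)
    have h2 : 0 ≤ 1 - Real.exp (-w y) := by simpa using hw y
    have h3 : 1 - Real.exp (-w y) ≤ 1 := by linarith [Real.exp_pos (-w y)]
    have h4 := mul_le_mul_of_nonneg_left h1 h2
    have h5 : (1 - Real.exp (-w y)) * ((a * p y / S) ^ 2 / 2) ≤ (a * p y / S) ^ 2 / 2 :=
      mul_le_of_le_one_left (by positivity) h3
    have e1 : (a / S) * ((1 - Real.exp (-w y)) * p y) = (1 - Real.exp (-w y)) * (a * p y / S) := by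
      ring
    have e2 : a ^ 2 / (2 * S ^ 2) * p y ^ 2 = (a * p y / S) ^ 2 / 2 := by
      field_simp
    rw [e1, e2]; linarith
  have hsum : ∑ y ∈ B, ((a / S) * ((1 - Real.exp (-w y)) * p y) - a ^ 2 / (2 * S ^ 2) * p y ^ 2) ≤
      ∑ y ∈ B, (1 - Real.exp (-w y)) * (1 - Real.exp (-(a * p y / S))) :=
    Finset.sum_le_sum fun y _ => hterm y
  refine le_trans ?_ hsum
  rw [Finset.sum_sub_distrib, ← Finset.mul_sum, ← Finset.mul_sum]
  have h1 : ∑ y ∈ B, p y ^ 2 ≤ ∑ y, p y ^ 2 :=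
    Finset.sum_le_sum_of_subset_of_nonneg (Finset.subset_univ _) fun z _ _ => sq_nonneg _
  have h2 : ∑ y, (1 - Real.exp (-w y)) * p y ≤
      ∑ y ∈ B, (1 - Real.exp (-w y)) * p y + ∑ z ∈ Bᶜ, p z := by
    rw [← Finset.sum_add_sum_compl B]
    gcongr with y _
    exact mul_le_of_le_one_left (hp y).le (by linarith [Real.exp_pos (-w y)])
  have h3 : a ^ 2 / (2 * S ^ 2) * ∑ y ∈ B, p y ^ 2 ≤ a ^ 2 / (2 * S ^ 2) * ∑ y, p y ^ 2 :=
    mul_le_mul_of_nonneg_left h1 (by positivity)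
  have h4 : (a / S) * (γ * S + a * (∑ z, p z ^ 2) / (2 * S)) ≤
      (a / S) * ∑ y ∈ B, (1 - Real.exp (-w y)) * p y :=
    mul_le_mul_of_nonneg_left (by linarith) (by positivity)
  have e : (a / S) * (γ * S + a * (∑ z, p z ^ 2) / (2 * S)) =
      γ * a + a ^ 2 / (2 * S ^ 2) * ∑ y, p y ^ 2 := by
    field_simp
  linarith

end FixedWeights

/-! ### Expansion of the exploration by a supermartingale -/

section Expansion

variable {V : Type*} [Fintype V] [DecidableEq V]

theorem bfsLayer_succ (c : Sym2 V → Bool) (x : V) (k : ℕ) :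
    bfsLayer c x (k + 1) = reachedFrom c (bfsLayer c x k) (explored c x (k + 1))ᶜ := by
  ext y
  rw [mem_bfsLayer_succ, reachedFrom, Finset.mem_filter, Finset.mem_compl]

/-- One step of the exploration, on the event that the explored ball is small. -/
theorem integral_exploration_step_le {p : V → ℝ} (hp : ∀ x, 0 < p x) (x : V) (k : ℕ) {M : ℝ}
    {w : V → ℝ} (hw : ∀ y, 0 ≤ w y) {a γ ε : ℝ}
    (hγ : (γ + ε) * ∑ z, p z ≤ ∑ y, (1 - Real.exp (-w y)) * p y)
    (hε : ∀ S : Finset V, (S.card : ℝ) ≤ M →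
      (∑ z ∈ S, p z) + (∑ z ∈ S, p z) * (∑ z, p z ^ 2) / (2 * ∑ z, p z) ≤ ε * ∑ z, p z) :
    ∫ c, (if ((explored c x (k + 1)).card : ℝ) ≤ M then
        Real.exp (a * ∑ v ∈ explored c x (k + 1), p v - ∑ v ∈ bfsLayer c x (k + 1), w v) else 0)
        ∂(edgeMeasure p) ≤
      ∫ c, (if ((explored c x (k + 1)).card : ℝ) ≤ M then
        Real.exp (a * ∑ v ∈ explored c x (k + 1), p v - γ * ∑ v ∈ bfsLayer c x k, p v) else 0)
        ∂(edgeMeasure p) := by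
  let X : (Sym2 V → Bool) → Finset V × Finset V := fun c => (explored c x k, explored c x (k + 1))
  let h : Finset V × Finset V → (Sym2 V → Bool) → ℝ := fun t c =>
    if ((t.1 ∪ t.2).card : ℝ) ≤ M then
      Real.exp (a * ∑ v ∈ t.1 ∪ t.2, p v) *
        Real.exp (-∑ y ∈ reachedFrom c (t.2 \ t.1) (t.1 ∪ t.2)ᶜ, w y) else 0
  let r : Finset V × Finset V → ℝ := fun t =>
    if ((t.1 ∪ t.2).card : ℝ) ≤ M then
      Real.exp (a * ∑ v ∈ t.1 ∪ t.2, p v - γ * ∑ v ∈ t.2 \ t.1, p v) else 0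
  have hvol : 0 ≤ ∑ z, p z := Finset.sum_nonneg fun z _ => (hp z).le
  have key := integral_label_le (edgeLaw p) X (fun t => pairsMeeting t.1)
    (dependsOn_explored_pair x k) h (fun t c c' hc => ?_) r (fun t => ?_)
  · have e1 : ∀ c, h (X c) c = if ((explored c x (k + 1)).card : ℝ) ≤ M then
        Real.exp (a * ∑ v ∈ explored c x (k + 1), p v - ∑ v ∈ bfsLayer c x (k + 1), w v) else 0 :=
      fun c => by
        simp only [h, X]
        rw [Finset.union_eq_right.2 (explored_subset_succ c x k), ← Real.exp_add,
          bfsLayer_succ, sub_eq_add_neg]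
        rfl
    have e2 : ∀ c, r (X c) = if ((explored c x (k + 1)).card : ℝ) ≤ M then
        Real.exp (a * ∑ v ∈ explored c x (k + 1), p v - γ * ∑ v ∈ bfsLayer c x k, p v) else 0 :=
      fun c => by
        simp only [r, X]
        rw [Finset.union_eq_right.2 (explored_subset_succ c x k)]
        rfl
    simp_rw [e1, e2] at key
    exact key
  · have : reachedFrom c (t.2 \ t.1) (t.1 ∪ t.2)ᶜ = reachedFrom c' (t.2 \ t.1) (t.1 ∪ t.2)ᶜ := by
      refine Finset.filter_congr fun y hy => ?_
      refine exists_congr fun v => and_congr_right fun hv => ?_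
      rw [dependsOn_edges_product Finset.sdiff_disjoint
        (disjoint_compl_left.mono_right Finset.subset_union_left) hc hv hy]
    simp only [h, this]
  · simp only [h, r]
    by_cases hM : ((t.1 ∪ t.2).card : ℝ) ≤ M
    · simp only [if_pos hM]
      rw [integral_const_mul, sub_eq_add_neg, Real.exp_add]
      refine mul_le_mul_of_nonneg_left ?_ (Real.exp_pos _).le
      refine integral_exp_neg_sum_reachedFrom_le_of_small hp
        (disjoint_compl_right.mono_left (Finset.sdiff_subset.trans Finset.subset_union_right))
        hw hγ (le_trans ?_ (hε _ hM))
      rw [compl_compl]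
      have h1 : ∑ z ∈ t.2 \ t.1, p z ≤ ∑ z ∈ t.1 ∪ t.2, p z :=
        Finset.sum_le_sum_of_subset_of_nonneg
          (Finset.sdiff_subset.trans Finset.subset_union_right) fun z _ _ => (hp z).le
      have h2 : 0 ≤ ∑ z, p z ^ 2 := Finset.sum_nonneg fun z _ => sq_nonneg _
      gcongr
    · simp [if_neg hM]

/-- The conditions on the weights under which the exploration expands: `θ` is the exponential
parameter, `η` the excess of the size-biased mean over `1`, and sets of at most `M` vertices have
negligible weight. -/
structure ExpandingWeights (p : V → ℝ) (θ η M : ℝ) : Prop where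
  theta_pos : 0 < θ
  theta_le : θ ≤ 1 / 10
  eta_pos : 0 < η
  eta_le : η ≤ 1
  excess : θ * (1 + 2 * η) * ∑ z, p z ≤ ∑ y, (1 - Real.exp (-(θ * p y))) * p y
  small : ∀ S : Finset V, (S.card : ℝ) ≤ M →
    (∑ z ∈ S, p z) + (∑ z ∈ S, p z) * (∑ z, p z ^ 2) / (2 * ∑ z, p z) ≤ θ * η * ∑ z, p z

/-- A step turns a layer of weight a into the factor exp(-θ(1+η)a), while the explored weight grows
by a and contributes exp(θηa). The product exp(-θa) is the old layer term, so the potential does not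
grow in expectation. The size cutoff is harmless because explored sets increase. -/
theorem ExpandingWeights.integral_potential_le_one {p : V → ℝ} {θ η M : ℝ}
    (h : ExpandingWeights p θ η M) (hp : ∀ x, 0 < p x) (x : V) (k : ℕ) :
    ∫ c, (if ((explored c x (k + 1)).card : ℝ) ≤ M then
        Real.exp (θ * η * ∑ v ∈ explored c x k, p v - ∑ v ∈ bfsLayer c x k, θ * p v) else 0)
        ∂(edgeMeasure p) ≤ 1 := by
  have := h.theta_pos
  induction k with
  | zero =>
    refine (integral_mono (integrable_boolProduct _ _) (integrable_const 1) fun c => ?_).trans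
      (by simp)
    simp only
    split_ifs
    · simp only [explored, Finset.sum_empty, mul_zero, zero_sub, Real.exp_le_one_iff, neg_nonpos]
      exact Finset.sum_nonneg fun v _ => mul_nonneg h.theta_pos.le (hp v).le
    · exact zero_le_one
  | succ k ih =>
    have step := integral_exploration_step_le hp x k (M := M) (w := fun y => θ * p y)
      (fun y => mul_nonneg h.theta_pos.le (hp y).le) (a := θ * η) (γ := θ * (1 + η)) (ε := θ * η)
      (by convert h.excess using 2; ring) h.small
    refine (integral_mono (integrable_boolProduct _ _) (integrable_boolProduct _ _) fun c => ?_).trans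
      (step.trans (le_of_eq_of_le (integral_congr_ae (ae_of_all _ fun c => ?_)) ih))
    · simp only
      have hcard : ((explored c x (k + 1)).card : ℝ) ≤ (explored c x (k + 1 + 1)).card := by
        exact_mod_cast Finset.card_le_card (explored_subset_succ c x (k + 1))
      split_ifs with h1 h2
      · exact le_rfl
      · exact absurd (hcard.trans h1) h2
      · exact (Real.exp_pos _).le
      · exact le_rfl
    · simp only
      rw [sum_explored_succ, ← Finset.mul_sum]
      congr 2
      ring

/-- A ball of intermediate size is unlikely to have a small edge boundary. -/
theorem ExpandingWeights.prob_small_boundary_le {p : V → ℝ} {θ η M : ℝ}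
    (h : ExpandingWeights p θ η M) {b : ℝ} (hb : 0 < b) (hp : ∀ x, b ≤ p x) (x : V) (k : ℕ)
    (m t : ℝ) :
    (edgeMeasure p).real {c | m ≤ (closedNeighborhood (configGraph c) x k).ncard ∧
      ((closedNeighborhood (configGraph c) x k).ncard : ℝ) ≤ M ∧
      (boundaryEdges (configGraph c) x k : ℝ) < t} ≤ Real.exp (t - θ * η * b * m) := by
  have hp' : ∀ x, 0 < p x := fun x => hb.trans_le (hp x)
  have h1 := h.theta_pos
  have h2 := h.eta_pos
  have hvol : 0 ≤ ∑ z, p z := Finset.sum_nonneg fun z _ => (hp' z).le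
  -- The last step counts vertices (weight 1) instead of their weights. The bounds θ ≤ 1/10 and η ≤
  -- 1 give θ(2 + η) ≤ 1/2 ≤ 1 - 1/e, so even the rate 2θ is available.
  have step := integral_exploration_step_le hp' x k (M := M) (w := fun _ => 1)
    (fun y => zero_le_one) (a := θ * η) (γ := 2 * θ) (ε := θ * η) (by
      rw [← Finset.mul_sum]
      refine mul_le_mul_of_nonneg_right ?_ hvol
      have h3 : Real.exp (-1) ≤ 1 / 2 := by
        rw [Real.exp_neg, one_div]
        exact inv_anti₀ (by norm_num) (by linarith [Real.add_one_le_exp 1])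
      nlinarith [h.theta_le, h.eta_le]) h.small
  have hpot := h.integral_potential_le_one hp' x k
  have hle : ∫ c, (if ((explored c x (k + 1)).card : ℝ) ≤ M then
        Real.exp (θ * η * ∑ v ∈ explored c x (k + 1), p v - ∑ v ∈ bfsLayer c x (k + 1), (1 : ℝ))
        else 0) ∂(edgeMeasure p) ≤ 1 := by
    refine step.trans ((integral_mono (integrable_boolProduct _ _) (integrable_boolProduct _ _)
      fun c => ?_).trans hpot)
    simp only
    split_ifs
    · rw [Real.exp_le_exp, sum_explored_succ, ← Finset.mul_sum]
      have h4 : 0 ≤ ∑ v ∈ bfsLayer c x k, p v := Finset.sum_nonneg fun z _ => (hp' z).le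
      have h5 : θ * η * ∑ v ∈ bfsLayer c x k, p v ≤ θ * ∑ v ∈ bfsLayer c x k, p v :=
        mul_le_mul_of_nonneg_right (mul_le_of_le_one_right h1.le h.eta_le) h4
      linarith
    · exact le_rfl
  refine (measureReal_le_integral_of_indicator_le (edgeLaw p)
    (f := fun c => Real.exp (t - θ * η * b * m) *
      (if ((explored c x (k + 1)).card : ℝ) ≤ M then
        Real.exp (θ * η * ∑ v ∈ explored c x (k + 1), p v - ∑ v ∈ bfsLayer c x (k + 1), (1 : ℝ))
        else 0)) (fun c => ?_) fun c hc => ?_).trans ?_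
  · split_ifs
    · positivity
    · simp
  · obtain ⟨c1, c2, c3⟩ := hc
    rw [← card_explored_succ] at c1 c2
    rw [if_pos c2, ← Real.exp_add]
    refine Real.one_le_exp ?_
    -- The boundary dominates the size of the next layer, so a small boundary with explored weight
    -- at least bm makes the exponent at least θηbm - t.
    have c4 : ((bfsLayer c x (k + 1)).card : ℝ) ≤ boundaryEdges (configGraph c) x k := by
      exact_mod_cast card_bfsLayer_succ_le c x k
    have c5 : b * m ≤ ∑ v ∈ explored c x (k + 1), p v := by
      have := Finset.card_nsmul_le_sum (explored c x (k + 1)) p b fun v _ => hp v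
      rw [nsmul_eq_mul] at this
      nlinarith
    have c6 := mul_le_mul_of_nonneg_left c5 (mul_pos h1 h2).le
    simp only [Finset.sum_const, nsmul_eq_mul, mul_one]
    linarith
  · rw [integral_const_mul]
    exact mul_le_of_le_one_right (Real.exp_pos _).le hle

end Expansion

/-! ### Degrees -/

section Degrees

variable {V : Type*} [Fintype V]

theorem injOn_mk_left {V : Type*} (z : V) (s : Set V) : Set.InjOn (fun y => s(z, y)) s := by
  intro y _ y' _ h
  exact Sym2.congr_right.1 h

theorem prob_sum_edgeInd_ge_le {p : V → ℝ} (hp : ∀ x, 0 < p x) (z : V) (B : Finset V) {μ L : ℝ}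
    (hμ : ∑ y ∈ B, edgeProb p s(z, y) ≤ μ) :
    (edgeMeasure p).real {c | 2 * μ + L ≤ ∑ y ∈ B, edgeInd c s(z, y)} ≤ Real.exp (-L) := by
  refine (measureReal_le_integral_of_indicator_le (edgeLaw p)
    (f := fun c => Real.exp (-(2 * μ + L)) * Real.exp (1 * ∑ y ∈ B, edgeInd c s(z, y)))
    (fun c => by positivity) fun c hc => ?_).trans ?_
  · rw [← Real.exp_add]
    refine Real.one_le_exp ?_
    have : 2 * μ + L ≤ ∑ y ∈ B, edgeInd c s(z, y) := hc
    linarith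
  · rw [integral_const_mul]
    have h0 : 0 ≤ ∑ y ∈ B, edgeProb p s(z, y) :=
      Finset.sum_nonneg fun y _ => edgeProb_nonneg (fun z => (hp z).le) _
    refine (mul_le_mul_of_nonneg_left (integral_exp_sum_edgeInd_le (fun z => (hp z).le) B
      (fun y => s(z, y)) (injOn_mk_left z _) 1) (Real.exp_pos _).le).trans ?_
    rw [← Real.exp_add, Real.exp_le_exp]
    -- Chernoff at parameter 1: e - 1 < 2 is what the factor 2μ pays for.
    nlinarith [Real.exp_one_lt_d9]

theorem prob_sum_edgeInd_le_le {p : V → ℝ} (hp : ∀ x, 0 < p x) (z : V) (B : Finset V) {μ L : ℝ}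
    (hμ0 : 0 ≤ μ) (hμ : μ ≤ ∑ y ∈ B, edgeProb p s(z, y)) :
    (edgeMeasure p).real {c | ∑ y ∈ B, edgeInd c s(z, y) ≤ μ / 2 - L} ≤ Real.exp (-L) := by
  refine (measureReal_le_integral_of_indicator_le (edgeLaw p)
    (f := fun c => Real.exp (μ / 2 - L) * Real.exp (-1 * ∑ y ∈ B, edgeInd c s(z, y)))
    (fun c => by positivity) fun c hc => ?_).trans ?_
  · rw [← Real.exp_add]
    refine Real.one_le_exp ?_
    have : ∑ y ∈ B, edgeInd c s(z, y) ≤ μ / 2 - L := hc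
    linarith
  · rw [integral_const_mul]
    refine (mul_le_mul_of_nonneg_left (integral_exp_sum_edgeInd_le (fun z => (hp z).le) B
      (fun y => s(z, y)) (injOn_mk_left z _) (-1)) (Real.exp_pos _).le).trans ?_
    rw [← Real.exp_add, Real.exp_le_exp]
    have h3 : Real.exp (-1) ≤ 1 / 2 := by
      rw [Real.exp_neg, one_div]
      exact inv_anti₀ (by norm_num) (by linarith [Real.add_one_le_exp 1])
    nlinarith

variable [DecidableEq V]

theorem ncard_neighbors_inter {V : Type*} [DecidableEq V] (c : Sym2 V → Bool) (z : V) (B : Finset V) :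
    (({y | (configGraph c).Adj z y ∧ y ∈ B}).ncard : ℝ) = ∑ y ∈ B.erase z, edgeInd c s(z, y) := by
  have : {y | (configGraph c).Adj z y ∧ y ∈ B} =
      ((B.erase z).filter fun y => c s(z, y) = true : Finset V) := by
    ext y
    simp only [Finset.coe_filter, Finset.mem_erase, Set.mem_ofPred_eq]
    constructor
    · rintro ⟨h, hy⟩; exact ⟨⟨h.1.symm, hy⟩, h.2⟩
    · rintro ⟨⟨h1, hy⟩, h2⟩; exact ⟨⟨h1.symm, h2⟩, hy⟩
  rw [this, Set.ncard_coe_finset, Finset.card_filter]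
  push_cast
  rfl

theorem ncard_neighborSet_configGraph (c : Sym2 V → Bool) (z : V) :
    (((configGraph c).neighborSet z).ncard : ℝ) = ∑ y ∈ Finset.univ.erase z, edgeInd c s(z, y) := by
  rw [← ncard_neighbors_inter]
  congr 2
  ext y; simp

/-- Few neighbors have at least the degree of the vertex, if degrees are close to weights and few
neighbors have a comparable weight. -/
theorem ncard_neighbors_of_larger_degree_le {p : V → ℝ} {κ L K : ℝ}
    (hκ : 0 < κ) (c : Sym2 V → Bool) (z : V)
    (hup : ∀ y, (((configGraph c).neighborSet y).ncard : ℝ) < 2 * p y + L)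
    (hlow : κ * p z / 2 - L < ((configGraph c).neighborSet z).ncard)
    (hheavy : ∑ y ∈ (Finset.univ.filter fun y => κ * p z / 8 ≤ p y).erase z,
      edgeInd c s(z, y) < K) (hK : 16 * L / κ + L ≤ K) :
    (({y | (configGraph c).Adj z y ∧ ((configGraph c).neighborSet z).ncard ≤
      ((configGraph c).neighborSet y).ncard}).ncard : ℝ) ≤ K := by
  -- For heavy z the degree bounds force p y ≥ κ p z / 8 on the neighbors counted. For light z the
  -- whole degree is already below 16L/κ + L.
  rcases le_or_gt L (κ * p z / 8) with h | h
  · refine le_trans ?_ hheavy.le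
    rw [← ncard_neighbors_inter]
    norm_cast
    refine Set.ncard_le_ncard ?_
    rintro y ⟨hzy, hd⟩
    refine ⟨hzy, ?_⟩
    have hd' : (((configGraph c).neighborSet z).ncard : ℝ) ≤ ((configGraph c).neighborSet y).ncard := by
      exact_mod_cast hd
    simp only [Finset.mem_filter, Finset.mem_univ, true_and]
    linarith [hup y]
  · have h1 : (({y | (configGraph c).Adj z y ∧ ((configGraph c).neighborSet z).ncard ≤
      ((configGraph c).neighborSet y).ncard}).ncard : ℝ) ≤ ((configGraph c).neighborSet z).ncard := by
      norm_cast
      exact Set.ncard_le_ncard fun y hy => hy.1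
    have h2 : 2 * p z ≤ 16 * L / κ := by
      rw [le_div_iff₀ hκ]; linarith
    linarith [hup z]

end Degrees

/-! ### Union bound for fixed weights -/

section UnionBound

variable {V : Type*} [Fintype V]

theorem measureReal_exists_le {Ω κ : Type*} [MeasurableSpace Ω] (μ : Measure Ω) [IsFiniteMeasure μ]
    (s : Finset κ) (f : κ → Set Ω) {e : ℝ} (h : ∀ i ∈ s, μ.real (f i) ≤ e) :
    μ.real (⋃ i ∈ s, f i) ≤ s.card * e := by
  refine (measureReal_biUnion_finset_le s f).trans ?_
  refine (Finset.sum_le_sum h).trans ?_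
  simp

/-- Chernoff at parameter 1/5 with s = 4t/5 gives the exponent (0.222·0.8 - 0.2)t < -t/50. -/
theorem exp_fifth_le : Real.exp (1 / 5) ≤ 1.222 := by
  refine le_of_pow_le_pow_left₀ (n := 5) (by norm_num) (by norm_num) ?_
  rw [← Real.exp_nat_mul]
  norm_num
  linarith [Real.exp_one_lt_d9]

/-- The two properties of a graph that make the labels a 2-hop cover of the required size. -/
def HasGoodLabels (G : SimpleGraph V) (t R : ℝ) : Prop :=
  (∀ x y : V, ∀ k j : ℕ, t ≤ boundaryEdges G x k → t ≤ boundaryEdges G y j →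
      G.edist x y ≤ (k + j + 1 : ℕ)) ∧
    ∀ x : V, ((localLandmarks G x (localRadius G t x)).ncard : ℝ) ≤ R

/-- Restricts the union bound to finitely many radii. -/
theorem le_card_of_boundaryEdges_pos (G : SimpleGraph V) {x : V} {k : ℕ}
    (h : 0 < boundaryEdges G x k) : k ≤ Fintype.card V := by
  by_contra hk
  push Not at hk
  obtain ⟨⟨v, y⟩, hv, hy, hvy⟩ := (Set.ncard_pos).1 h
  refine hy (closedNeighborhood_mono G x hk.le ?_)
  exact closedNeighborhood_subset_card G x (k + 1)
    ((mem_closedNeighborhood_succ G).2 (Or.inr ⟨v, hv, hvy⟩))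

variable [DecidableEq V]

/-- A common vertex of the balls gives a distance of at most k + j; an open pair between the layers
costs one more. -/
theorem edist_le_of_layers (c : Sym2 V → Bool) {x y : V} {k j : ℕ}
    (h : ¬ (Disjoint (explored c x (k + 1)) (explored c y (j + 1)) ∧
      ∀ v ∈ bfsLayer c x k, ∀ w ∈ bfsLayer c y j, c s(v, w) = false)) :
    (configGraph c).edist x y ≤ (k + j + 1 : ℕ) := by
  have ball : ∀ {x v : V} {k : ℕ}, v ∈ explored c x (k + 1) → (configGraph c).edist x v ≤ k :=
    fun {x v k} hv => by
      have := Finset.mem_coe.2 hv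
      rw [coe_explored_succ] at this
      exact this
  rw [not_and_or] at h
  rcases h with h | h
  · obtain ⟨v, hv, hw⟩ := Finset.not_disjoint_iff.1 h
    refine ((configGraph c).edist_triangle (v := v)).trans ?_
    rw [SimpleGraph.edist_comm (u := v)]
    refine (add_le_add (ball hv) (ball hw)).trans ?_
    norm_cast; omega
  · push Not at h
    obtain ⟨v, hv, w, hw, hvw⟩ := h
    have hv' := ball (Finset.mem_sdiff.1 hv).1
    have hw' := ball (Finset.mem_sdiff.1 hw).1
    have hvw' : (configGraph c).edist v w ≤ 1 := by
      rw [SimpleGraph.edist_le_one_iff_adj_or_eq]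
      by_cases e : v = w
      · exact Or.inr e
      · exact Or.inl ⟨e, by simpa using hvw⟩
    refine ((configGraph c).edist_triangle (v := v)).trans ?_
    refine (add_le_add hv' ((configGraph c).edist_triangle (v := w))).trans ?_
    rw [SimpleGraph.edist_comm (u := w)]
    refine (add_le_add le_rfl (add_le_add hvw' hw')).trans ?_
    norm_cast; omega

/-- On the heavy vertices p z is at most 8 p y / κ, which turns the expected number of heavy
neighbors into a second moment independent of z. -/
theorem sum_edgeProb_heavy_le {p : V → ℝ} (hp : ∀ x, 0 < p x) {κ : ℝ} (hκ : 0 < κ) (z : V) :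
    ∑ y ∈ (Finset.univ.filter fun y => κ * p z / 8 ≤ p y).erase z, edgeProb p s(z, y) ≤
      8 * (∑ y, p y ^ 2) / (κ * ∑ y, p y) := by
  have hvol : 0 < ∑ z, p z := Finset.sum_pos (fun z _ => hp z) ⟨z, Finset.mem_univ _⟩
  have h1 : ∀ y ∈ (Finset.univ.filter fun y => κ * p z / 8 ≤ p y).erase z,
      edgeProb p s(z, y) ≤ 8 * p y ^ 2 / (κ * ∑ y, p y) := fun y hy => by
    refine (edgeProb_mk_le p z y).trans ?_
    have hy' : κ * p z / 8 ≤ p y := (Finset.mem_filter.1 (Finset.mem_erase.1 hy).2).2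
    rw [div_le_div_iff₀ hvol (by positivity)]
    have := mul_le_mul_of_nonneg_right hy' (hp y).le
    nlinarith
  refine (Finset.sum_le_sum h1).trans ?_
  rw [← Finset.sum_div, ← Finset.mul_sum]
  gcongr
  exact Finset.subset_univ _

/-- The bad events are: separated heavy layers, a large boundary on a light layer, a small boundary
of a medium ball, a degree too large, a degree too small, too many heavy neighbors. Each has
probability at most e^{-L}, and 2μ + L + 16L/κ bounds the number of neighbors of at least equal
degree. -/
theorem ExpandingWeights.prob_not_hasGoodLabels_le {p : V → ℝ} {b θ η t m κ L μ : ℝ}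
    (hb : 0 < b) (hp : ∀ x, b ≤ p x) (h : ExpandingWeights p θ η (2 * m)) (ht : 1 ≤ t)
    (htm : t ≤ m) (hm : 1 < m) (hκ : 0 < κ)
    (hdeg : ∀ z, κ * p z ≤ ∑ y ∈ Finset.univ.erase z, edgeProb p s(z, y))
    (hμ : 8 * (∑ y, p y ^ 2) / (κ * ∑ y, p y) ≤ μ) (hL : 0 ≤ L)
    (hL1 : L ≤ (4 / 5 * t) ^ 2 / ∑ z, p z) (hL2 : L ≤ t / 50) (hL3 : t + L ≤ θ * η * b * m) :
    (edgeMeasure p).real {c | ¬ HasGoodLabels (configGraph c) t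
      (2 * m + t * (2 * μ + L + 16 * L / κ))} ≤
      11 * (Fintype.card V : ℝ) ^ 4 * Real.exp (-L) := by
  have hp' : ∀ x, 0 < p x := fun x => hb.trans_le (hp x)
  set N := Fintype.card V with hN
  let R := Finset.range (N + 1)
  let f1 : (V × V) × (ℕ × ℕ) → Set (Sym2 V → Bool) := fun i =>
    {c | 4 / 5 * t ≤ ∑ v ∈ bfsLayer c i.1.1 i.2.1, p v ∧
      4 / 5 * t ≤ ∑ v ∈ bfsLayer c i.1.2 i.2.2, p v ∧
      Disjoint (explored c i.1.1 (i.2.1 + 1)) (explored c i.1.2 (i.2.2 + 1)) ∧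
      ∀ v ∈ bfsLayer c i.1.1 i.2.1, ∀ w ∈ bfsLayer c i.1.2 i.2.2, c s(v, w) = false}
  let f2 : V × ℕ → Set (Sym2 V → Bool) := fun i =>
    {c | t ≤ boundaryEdges (configGraph c) i.1 i.2 ∧ ∑ v ∈ bfsLayer c i.1 i.2, p v ≤ 4 / 5 * t}
  let f3 : V × ℕ → Set (Sym2 V → Bool) := fun i =>
    {c | m ≤ (closedNeighborhood (configGraph c) i.1 i.2).ncard ∧
      ((closedNeighborhood (configGraph c) i.1 i.2).ncard : ℝ) ≤ 2 * m ∧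
      (boundaryEdges (configGraph c) i.1 i.2 : ℝ) < t}
  let f4 : V → Set (Sym2 V → Bool) := fun z =>
    {c | 2 * p z + L ≤ ∑ y ∈ Finset.univ.erase z, edgeInd c s(z, y)}
  let f5 : V → Set (Sym2 V → Bool) := fun z =>
    {c | ∑ y ∈ Finset.univ.erase z, edgeInd c s(z, y) ≤ κ * p z / 2 - L}
  let f6 : V → Set (Sym2 V → Bool) := fun z =>
    {c | 2 * μ + L ≤
      ∑ y ∈ (Finset.univ.filter fun y => κ * p z / 8 ≤ p y).erase z, edgeInd c s(z, y)}
  have b1 := measureReal_exists_le (edgeMeasure p) (Finset.univ ×ˢ (R ×ˢ R)) f1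
    (e := Real.exp (-L)) fun i _ => by
      refine (prob_separated_layers_le hp' _ _ _ _ (by linarith)).trans ?_
      rw [Real.exp_le_exp]; linarith
  have b2 := measureReal_exists_le (edgeMeasure p) (Finset.univ ×ˢ R) f2
    (e := Real.exp (-L)) fun i _ => by
      refine (prob_boundaryEdges_ge_le hp' _ _ (l := 1 / 5) (by norm_num)).trans ?_
      rw [Real.exp_le_exp]
      nlinarith [exp_fifth_le]
  have b3 := measureReal_exists_le (edgeMeasure p) (Finset.univ ×ˢ R) f3
    (e := Real.exp (-L)) fun i _ => by
      refine (h.prob_small_boundary_le hb hp _ _ m t).trans ?_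
      rw [Real.exp_le_exp]; linarith
  have b4 := measureReal_exists_le (edgeMeasure p) Finset.univ f4
    (e := Real.exp (-L)) fun z _ => by
      refine prob_sum_edgeInd_ge_le hp' z _ ?_
      refine (Finset.sum_le_sum fun y _ => edgeProb_mk_le p z y).trans ?_
      exact sum_mul_div_le hp' (hp' z).le _
  have b5 := measureReal_exists_le (edgeMeasure p) Finset.univ f5
    (e := Real.exp (-L)) fun z _ =>
      prob_sum_edgeInd_le_le hp' z _ (mul_pos hκ (hp' z)).le (hdeg z)
  have b6 := measureReal_exists_le (edgeMeasure p) Finset.univ f6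
    (e := Real.exp (-L)) fun z _ =>
      prob_sum_edgeInd_ge_le hp' z _ ((sum_edgeProb_heavy_le hp' hκ z).trans hμ)
  have hsub : {c | ¬ HasGoodLabels (configGraph c) t (2 * m + t * (2 * μ + L + 16 * L / κ))} ⊆
      (⋃ i ∈ Finset.univ ×ˢ (R ×ˢ R), f1 i) ∪ ((⋃ i ∈ Finset.univ ×ˢ R, f2 i) ∪
        ((⋃ i ∈ Finset.univ ×ˢ R, f3 i) ∪ ((⋃ i ∈ Finset.univ, f4 i) ∪
          ((⋃ i ∈ Finset.univ, f5 i) ∪ ⋃ i ∈ Finset.univ, f6 i)))) := by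
    intro c hc
    by_contra hcon
    simp only [Set.mem_union, Set.mem_iUnion, not_or, not_exists, exists_prop, not_and] at hcon
    obtain ⟨g1, g2, g3, g4, g5, g6⟩ := hcon
    have memR : ∀ {k}, k ≤ N → k ∈ R := fun hk => Finset.mem_range.2 (Nat.lt_succ_of_le hk)
    refine hc ⟨fun x y k j hxk hyj => ?_, fun x => ?_⟩
    · have posb : ∀ {x : V} {k : ℕ}, t ≤ boundaryEdges (configGraph c) x k →
          k ∈ R := fun {x k} hx => memR (le_card_of_boundaryEdges_pos (configGraph c) (by
            have : (0 : ℝ) < boundaryEdges (configGraph c) x k := by linarith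
            exact_mod_cast this))
      have heavy : ∀ {x : V} {k : ℕ}, t ≤ boundaryEdges (configGraph c) x k →
          4 / 5 * t ≤ ∑ v ∈ bfsLayer c x k, p v := fun {x k} hx => by
        by_contra hlt
        exact g2 (x, k) (by simpa using posb hx) ⟨hx, (not_le.1 hlt).le⟩
      refine edist_le_of_layers c fun hsep => ?_
      exact g1 ((x, y), (k, j)) (by simpa using ⟨posb hxk, posb hyj⟩)
        ⟨heavy hxk, heavy hyj, hsep⟩
    · refine ncard_localLandmarks_le (configGraph c) ht htm hm x (fun k hk h1 h2 => ?_) fun z => ?_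
      · by_contra hlt
        exact g3 (x, k) (by simpa using memR hk) ⟨h1, h2, not_le.1 hlt⟩
      · have hμ0 : 0 ≤ μ := le_trans (div_nonneg
          (mul_nonneg (by norm_num) (Finset.sum_nonneg fun z _ => sq_nonneg _))
          (mul_nonneg hκ.le (Finset.sum_nonneg fun z _ => (hp' z).le))) hμ
        refine ncard_neighbors_of_larger_degree_le hκ (p := p) (L := L) c z (fun y => ?_) ?_ ?_
          (by linarith)
        · rw [ncard_neighborSet_configGraph]
          exact not_le.1 (g4 y (Finset.mem_univ _))
        · rw [ncard_neighborSet_configGraph]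
          exact not_le.1 (g5 z (Finset.mem_univ _))
        · refine (not_le.1 (g6 z (Finset.mem_univ _))).trans_le ?_
          have : 0 ≤ 16 * L / κ := by positivity
          linarith
  refine (measureReal_mono hsub).trans ?_
  have u := (measureReal_union_le (μ := edgeMeasure p) (⋃ i ∈ Finset.univ ×ˢ (R ×ˢ R), f1 i) _).trans
    (add_le_add_right ((measureReal_union_le (μ := edgeMeasure p) (⋃ i ∈ Finset.univ ×ˢ R, f2 i) _).trans
    (add_le_add_right ((measureReal_union_le (μ := edgeMeasure p) (⋃ i ∈ Finset.univ ×ˢ R, f3 i) _).trans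
    (add_le_add_right ((measureReal_union_le (μ := edgeMeasure p) (⋃ i ∈ Finset.univ, f4 i) _).trans
    (add_le_add_right (measureReal_union_le (μ := edgeMeasure p) (⋃ i ∈ Finset.univ, f5 i)
      (⋃ i ∈ Finset.univ, f6 i)) _)) _)) _)) _)
  refine u.trans ?_
  simp only [Finset.card_product, Finset.card_univ, Fintype.card_prod, R, Finset.card_range, ← hN,
    Nat.cast_mul, Nat.cast_add, Nat.cast_one] at b1 b2 b3 b4 b5 b6
  have hE := Real.exp_pos (-L)
  have hN1 : (N : ℝ) = 0 ∨ (1 : ℝ) ≤ N := by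
    rcases Nat.eq_zero_or_pos N with h0 | h0
    · left; exact_mod_cast h0
    · right; exact_mod_cast h0
  -- The six families contribute 4 + 2 + 2 + 1 + 1 + 1 = 11 times N⁴.
  have c1 : (N : ℝ) * N * ((N + 1) * (N + 1)) ≤ 4 * (N : ℝ) ^ 4 := by
    rcases hN1 with h0 | hN1
    · simp [h0]
    have : ((N : ℝ) + 1) * (N + 1) ≤ 4 * (N : ℝ) ^ 2 := by nlinarith
    nlinarith [mul_le_mul_of_nonneg_left this (by positivity : 0 ≤ (N : ℝ) * N)]
  have c2 : (N : ℝ) * (N + 1) ≤ 2 * (N : ℝ) ^ 4 := by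
    rcases hN1 with h0 | hN1
    · simp [h0]
    have c0 : (N : ℝ) ^ 2 ≤ (N : ℝ) ^ 4 := pow_le_pow_right₀ hN1 (by norm_num)
    nlinarith
  have c3 : (N : ℝ) ≤ (N : ℝ) ^ 4 := by
    rcases hN1 with h0 | hN1
    · simp [h0]
    · exact le_self_pow₀ hN1 (by norm_num)
  have d1 := mul_le_mul_of_nonneg_right c1 hE.le
  have d2 := mul_le_mul_of_nonneg_right c2 hE.le
  have d3 := mul_le_mul_of_nonneg_right c3 hE.le
  linarith

end UnionBound

/-! ### The weights -/

section Weights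

theorem isProbabilityMeasure_powerLaw {xmin β : ℝ} (hx : 0 < xmin) (hβ : 3 < β) :
    IsProbabilityMeasure (powerLaw xmin β) :=
  isProbabilityMeasure_paretoMeasure hx (by linarith)

theorem ae_le_powerLaw (xmin β : ℝ) : ∀ᵐ x ∂(powerLaw xmin β), xmin ≤ x := by
  have hpdf : powerLaw xmin β = volume.withDensity
      (fun x => ENNReal.ofReal (paretoPDFReal xmin (β - 1) x)) := rfl
  rw [hpdf, ae_withDensity_iff (measurable_paretoPDFReal _ _).ennreal_ofReal]
  refine ae_of_all _ fun x hx => ?_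
  by_contra h
  exact hx (paretoPDF_of_lt (not_le.1 h))

/-- The integrand is of order x^{2-β}, and 2 - β < -1 is exactly β > 3. -/
theorem integrable_sq_powerLaw {xmin β : ℝ} (hx : 0 < xmin) (hβ : 3 < β) :
    Integrable (fun x => x ^ 2) (powerLaw xmin β) := by
  have hpdf : powerLaw xmin β = volume.withDensity
      (fun x => ENNReal.ofReal (paretoPDFReal xmin (β - 1) x)) := rfl
  rw [hpdf, integrable_withDensity_iff (measurable_paretoPDFReal _ _).ennreal_ofReal
    (ae_of_all _ fun _ => ENNReal.ofReal_lt_top)]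
  have h1 : IntegrableOn (fun x : ℝ => (β - 1) * xmin ^ (β - 1) * x ^ (2 - β)) (Set.Ioi xmin) :=
    (integrableOn_Ioi_rpow_of_lt (by linarith) hx).const_mul _
  have h2 := ((integrableOn_Ici_iff_integrableOn_Ioi (by finiteness)).2 h1).integrable_indicator measurableSet_Ici
  refine h2.congr (ae_of_all _ fun x => ?_)
  simp only
  rw [ENNReal.toReal_ofReal (paretoPDFReal_nonneg hx.le (by linarith) x), paretoPDFReal]
  by_cases hxx : xmin ≤ x
  · have hx0 : 0 < x := hx.trans_le hxx
    rw [Set.indicator_of_mem (by exact hxx), if_pos hxx]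
    have : x ^ (2 - β) = x ^ 2 * x ^ (-(β - 1 + 1)) := by
      rw [← Real.rpow_natCast, ← Real.rpow_add hx0]
      congr 1; push_cast; ring
    rw [this]; ring
  · rw [Set.indicator_of_notMem (by exact hxx), if_neg hxx, mul_zero]

theorem memLp_two_powerLaw {xmin β : ℝ} (hx : 0 < xmin) (hβ : 3 < β) :
    MemLp (fun x : ℝ => x) 2 (powerLaw xmin β) :=
  (memLp_two_iff_integrable_sq aestronglyMeasurable_id).2 (integrable_sq_powerLaw hx hβ)

/-- The size-biased mean exceeds `1`, and this excess is visible in an exponential moment. -/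
theorem exists_exponential_excess {μ : Measure ℝ} [IsProbabilityMeasure μ] {b ν : ℝ} (hb : 0 < b)
    (hμb : ∀ᵐ x ∂μ, b ≤ x) (h2 : MemLp (fun x : ℝ => x) 2 μ) (hν : ∫ x, x ∂μ = ν) (hν1 : 1 < ν) :
    ∃ θ η : ℝ, 0 < θ ∧ θ ≤ 1 / 10 ∧ 0 < η ∧ η ≤ 1 ∧
      0 < ∫ x, ((1 - Real.exp (-(θ * x))) * x - θ * (1 + 2 * η) * x) ∂μ := by
  have hsq : Integrable (fun x : ℝ => x ^ 2) μ := h2.integrable_sq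
  have hid : Integrable (fun x : ℝ => x) μ := h2.integrable (by norm_num)
  -- Nonnegativity of the variance gives E x² ≥ ν² > ν.
  have hvar : ν < ∫ x, x ^ 2 ∂μ := by
    have h := variance_nonneg (fun x : ℝ => x) μ
    rw [variance_eq_sub h2] at h
    have e : ∫ x, ((fun x : ℝ => x) ^ 2) x ∂μ = ∫ x, x ^ 2 ∂μ := rfl
    rw [e, hν] at h
    nlinarith
  obtain ⟨η, hη0, hη1, hη⟩ : ∃ η : ℝ, 0 < η ∧ η ≤ 1 ∧ (1 + 2 * η) * ν < ∫ x, x ^ 2 ∂μ := by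
    refine ⟨min 1 ((∫ x, x ^ 2 ∂μ - ν) / (4 * ν)), lt_min one_pos (div_pos (by linarith) (by linarith)),
      min_le_left _ _, ?_⟩
    have := min_le_right 1 ((∫ x, x ^ 2 ∂μ - ν) / (4 * ν))
    rw [le_div_iff₀ (by linarith)] at this
    nlinarith
  have hbound : ∀ θ x : ℝ, 0 < θ → b ≤ x →
      0 ≤ (1 - Real.exp (-(θ * x))) / θ * x ∧ (1 - Real.exp (-(θ * x))) / θ * x ≤ x ^ 2 :=
    fun θ x hθ hx => by
      have hx0 : 0 < x := hb.trans_le hx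
      have e1 : 0 ≤ 1 - Real.exp (-(θ * x)) := by
        simpa using (mul_pos hθ hx0).le
      have e2 : (1 - Real.exp (-(θ * x))) / θ ≤ x := by
        rw [div_le_iff₀ hθ]
        linarith [Real.add_one_le_exp (-(θ * x))]
      refine ⟨by positivity, ?_⟩
      nlinarith
  have hmeas : ∀ θ : ℝ, AEStronglyMeasurable (fun x : ℝ => (1 - Real.exp (-(θ * x))) / θ * x) μ :=
    fun θ => (by fun_prop : Measurable fun x : ℝ => (1 - Real.exp (-(θ * x))) / θ * x).aestronglyMeasurable
  -- Dominated convergence with majorant x²; the integrand tends to x², so a small θ retains the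
  -- strict excess.
  have hlim : Tendsto (fun θ : ℝ => ∫ x, (1 - Real.exp (-(θ * x))) / θ * x ∂μ) (𝓝[>] 0)
      (𝓝 (∫ x, x ^ 2 ∂μ)) := by
    refine tendsto_integral_filter_of_dominated_convergence (fun x => x ^ 2)
      (Eventually.of_forall hmeas) ?_ hsq (ae_of_all _ fun x => ?_)
    · filter_upwards [self_mem_nhdsWithin] with θ hθ
      filter_upwards [hμb] with x hx
      have := hbound θ x hθ hx
      rw [Real.norm_of_nonneg this.1]
      exact this.2
    · have hd : HasDerivAt (fun θ : ℝ => 1 - Real.exp (-(θ * x))) x 0 := by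
        have := ((((hasDerivAt_id (0 : ℝ)).mul_const x).neg).exp).const_sub 1
        simpa using this
      have h1 := hd.tendsto_slope_zero_right
      have h2 : Tendsto (fun θ : ℝ => (1 - Real.exp (-(θ * x))) / θ) (𝓝[>] 0) (𝓝 x) := by
        refine h1.congr fun θ => ?_
        simp [div_eq_inv_mul]
      simpa [sq] using h2.mul_const x
  have hev := (hlim.eventually (lt_mem_nhds hη)).and
    (Ioc_mem_nhdsGT (show (0 : ℝ) < 1 / 10 by norm_num))
  obtain ⟨θ, hθ, hθ0, hθ1⟩ := hev.exists
  refine ⟨θ, η, hθ0, hθ1, hη0, hη1, ?_⟩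
  have hint : Integrable (fun x : ℝ => (1 - Real.exp (-(θ * x))) / θ * x) μ := by
    refine hsq.mono' (hmeas θ) ?_
    filter_upwards [hμb] with x hx
    have := hbound θ x hθ0 hx
    rw [Real.norm_of_nonneg this.1]
    exact this.2
  have e : ∀ x : ℝ, (1 - Real.exp (-(θ * x))) * x - θ * (1 + 2 * η) * x =
      θ * ((1 - Real.exp (-(θ * x))) / θ * x - (1 + 2 * η) * x) := fun x => by
    field_simp
  simp_rw [e]
  rw [integral_const_mul, integral_sub hint (hid.const_mul _), integral_const_mul, hν]
  exact mul_pos hθ0 (by linarith)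

/-- A weak law of large numbers in the finite products of a probability measure. -/
theorem tendsto_pi_sum_le {μ : Measure ℝ} [IsProbabilityMeasure μ] {F : ℝ → ℝ} (hF : MemLp F 2 μ)
    {a : ℝ} (ha : a < ∫ x, F x ∂μ) :
    Tendsto (fun n : ℕ => Measure.pi (fun _ : Fin n => μ) {p | ∑ i, F (p i) ≤ a * n}) atTop (𝓝 0) := by
  set d := ∫ x, F x ∂μ - a with hd
  have hd0 : 0 < d := by linarith
  have key : ∀ n : ℕ, 0 < n → Measure.pi (fun _ : Fin n => μ) {p | ∑ i, F (p i) ≤ a * n} ≤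
      ENNReal.ofReal (Var[F; μ] / d ^ 2 / n) := by
    intro n hn
    have hn' : (0 : ℝ) < n := by exact_mod_cast hn
    have hmem : ∀ i : Fin n, MemLp (fun p : Fin n → ℝ => F (p i)) 2 (Measure.pi fun _ => μ) :=
      fun i => hF.comp_measurePreserving (measurePreserving_eval (fun _ : Fin n => μ) i)
    have hX : MemLp (∑ i : Fin n, fun p : Fin n → ℝ => F (p i)) 2 (Measure.pi fun _ => μ) :=
      memLp_finsetSum' _ fun i _ => hmem i
    have hmean : ∫ p, (∑ i : Fin n, fun p : Fin n → ℝ => F (p i)) p ∂(Measure.pi fun _ => μ) =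
        n * ∫ x, F x ∂μ := by
      simp only [Finset.sum_apply]
      rw [integral_finsetSum _ fun i _ => (hmem i).integrable (by norm_num)]
      have : ∀ i : Fin n, ∫ p : Fin n → ℝ, F (p i) ∂(Measure.pi fun _ => μ) = ∫ x, F x ∂μ :=
        fun i => by
          have hmp := measurePreserving_eval (fun _ : Fin n => μ) i
          rw [← integral_map (φ := fun p : Fin n → ℝ => p i) (measurable_pi_apply i).aemeasurable,
            hmp.map_eq]
          rw [hmp.map_eq]; exact hF.1
      simp [this]
    -- Chebyshev: the variance of the sum is n·Var F, the deviation nd.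
    have hch := meas_ge_le_variance_div_sq hX (c := n * d) (by positivity)
    rw [hmean, variance_sum_pi fun _ => hF] at hch
    refine (measure_mono fun p hp => ?_).trans (hch.trans (le_of_eq ?_))
    · have hp' : ∑ i, F (p i) ≤ a * n := hp
      show n * d ≤ |(∑ i : Fin n, fun p : Fin n → ℝ => F (p i)) p - n * ∫ x, F x ∂μ|
      rw [Finset.sum_apply, abs_sub_comm]
      refine le_trans ?_ (le_abs_self _)
      rw [hd]; linarith
    · congr 1
      simp only [Finset.sum_const, Finset.card_univ, Fintype.card_fin, nsmul_eq_mul]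
      field_simp
  have hlim : Tendsto (fun n : ℕ => ENNReal.ofReal (Var[F; μ] / d ^ 2 / n)) atTop (𝓝 0) := by
    have := ENNReal.tendsto_ofReal (tendsto_const_div_atTop_nhds_zero_nat (Var[F; μ] / d ^ 2))
    simpa using this
  refine tendsto_of_tendsto_of_tendsto_of_le_of_le' tendsto_const_nhds hlim
    (Eventually.of_forall fun _ => zero_le) ?_
  filter_upwards [eventually_gt_atTop 0] with n hn using key n hn

/-- Sums of nonnegative integrable variables are at most `n log n` with high probability. -/
theorem tendsto_pi_sum_gt_log {μ : Measure ℝ} [IsProbabilityMeasure μ] {F : ℝ → ℝ}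
    (hF : Integrable F μ) (hF0 : ∀ x, 0 ≤ F x) :
    Tendsto (fun n : ℕ => Measure.pi (fun _ : Fin n => μ) {p | n * Real.log n < ∑ i, F (p i)})
      atTop (𝓝 0) := by
  have key : ∀ n : ℕ, 1 < n → Measure.pi (fun _ : Fin n => μ) {p | n * Real.log n < ∑ i, F (p i)} ≤
      ENNReal.ofReal ((∫ x, F x ∂μ) / Real.log n) := by
    intro n hn
    have hn' : (1 : ℝ) < n := by exact_mod_cast hn
    have hlog : 0 < Real.log n := Real.log_pos hn'
    have hmp := fun i => measurePreserving_eval (fun _ : Fin n => μ) i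
    have hint : ∀ i : Fin n, Integrable (fun p : Fin n → ℝ => F (p i)) (Measure.pi fun _ => μ) :=
      fun i => (hmp i).integrable_comp_of_integrable hF
    have hmean : ∫ p : Fin n → ℝ, ∑ i, F (p i) ∂(Measure.pi fun _ => μ) = n * ∫ x, F x ∂μ := by
      rw [integral_finsetSum _ fun i _ => hint i]
      have : ∀ i : Fin n, ∫ p : Fin n → ℝ, F (p i) ∂(Measure.pi fun _ => μ) = ∫ x, F x ∂μ :=
        fun i => by
          rw [← integral_map (φ := fun p : Fin n → ℝ => p i) (measurable_pi_apply i).aemeasurable,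
            (hmp i).map_eq]
          rw [(hmp i).map_eq]; exact hF.1
      simp [this]
    have hmk := mul_meas_ge_le_integral_of_nonneg (μ := Measure.pi fun _ : Fin n => μ)
      (f := fun p : Fin n → ℝ => ∑ i, F (p i))
      (ae_of_all _ fun p => Finset.sum_nonneg fun i _ => hF0 _)
      (integrable_finsetSum _ fun i _ => hint i) (n * Real.log n)
    rw [hmean] at hmk
    rw [← ENNReal.ofReal_toReal (measure_ne_top (Measure.pi fun _ : Fin n => μ) _)]
    refine ENNReal.ofReal_le_ofReal ?_
    rw [le_div_iff₀ hlog]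
    have hle : (Measure.pi fun _ : Fin n => μ).real {p | n * Real.log n < ∑ i, F (p i)} ≤
        (Measure.pi fun _ : Fin n => μ).real {p | n * Real.log n ≤ ∑ i, F (p i)} :=
      measureReal_mono fun p (hp : n * Real.log n < ∑ i, F (p i)) =>
        show n * Real.log n ≤ ∑ i, F (p i) from hp.le
    rw [← measureReal_def]
    have h3 : (n : ℝ) * (Real.log n * (Measure.pi fun _ : Fin n => μ).real
      {p | n * Real.log n ≤ ∑ i, F (p i)}) ≤ n * ∫ x, F x ∂μ := by linarith
    have h4 := le_of_mul_le_mul_left h3 (by linarith)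
    nlinarith
  have hlim : Tendsto (fun n : ℕ => ENNReal.ofReal ((∫ x, F x ∂μ) / Real.log n)) atTop (𝓝 0) := by
    have := ENNReal.tendsto_ofReal ((tendsto_const_nhds (x := ∫ x, F x ∂μ)).div_atTop
      (Real.tendsto_log_atTop.comp tendsto_natCast_atTop_atTop))
    simpa using this
  refine tendsto_of_tendsto_of_tendsto_of_le_of_le' tendsto_const_nhds hlim
    (Eventually.of_forall fun _ => zero_le) ?_
  filter_upwards [eventually_gt_atTop 1] with n hn using key n hn

end Weights

/-! ### Choice of parameters for large n -/

section Asymptotics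

theorem eventually_log_bounds (A B : ℝ) :
    ∀ᶠ n : ℕ in atTop, A ≤ Real.log n ∧ B * Real.log n ^ 5 ≤ √(n : ℝ) := by
  refine ((Real.tendsto_log_atTop.comp tendsto_natCast_atTop_atTop).eventually_ge_atTop A).and ?_
  have h := isLittleO_log_rpow_rpow_atTop (s := 1 / 2) 5 (by norm_num)
  have h2 := (h.comp_tendsto tendsto_natCast_atTop_atTop).bound
    (show (0 : ℝ) < 1 / (|B| + 1) by positivity)
  filter_upwards [h2, eventually_gt_atTop 1] with n hn h1
  have h1' : (1 : ℝ) < n := by exact_mod_cast h1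
  have hlog := Real.log_pos h1'
  simp only [Function.comp_apply] at hn
  rw [← Real.sqrt_eq_rpow, Real.norm_of_nonneg (by positivity), Real.norm_of_nonneg (by positivity),
    show (5 : ℝ) = (5 : ℕ) by norm_num, Real.rpow_natCast, one_div, inv_mul_eq_div,
    le_div_iff₀ (by positivity)] at hn
  have : B * Real.log n ^ 5 ≤ |B| * Real.log n ^ 5 :=
    mul_le_mul_of_nonneg_right (le_abs_self B) (by positivity)
  have : 0 ≤ Real.log n ^ 5 := by positivity
  nlinarith

theorem HasGoodLabels.mono {V : Type*} {G : SimpleGraph V} [Fintype V] {t R R' : ℝ}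
    (h : HasGoodLabels G t R) (hR : R ≤ R') : HasGoodLabels G t R' :=
  ⟨h.1, fun x => (h.2 x).trans hR⟩

theorem mul_card_le_sum {n : ℕ} {p : Fin n → ℝ} {b : ℝ} (hp : ∀ i, b ≤ p i) : b * n ≤ ∑ i, p i := by
  have := Finset.card_nsmul_le_sum Finset.univ p b fun i _ => hp i
  simp only [Finset.card_univ, Fintype.card_fin, nsmul_eq_mul] at this
  linarith

theorem expandingWeights_of_typical {n : ℕ} {p : Fin n → ℝ} {b θ η α l r m : ℝ} (hb : 0 < b)
    (hθ : 0 < θ) (hθ1 : θ ≤ 1 / 10) (hη : 0 < η) (hη1 : η ≤ 1) (hl1 : 1 ≤ l) (hrr : r * r = n)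
    (hα : α = θ * η * b / (1 + 1 / (2 * b))) (hα0 : 0 < α) (hB2 : 2 * l ^ 5 ≤ α ^ 2 * r)
    (hm : m = r * l ^ 2) (hm1 : 1 < m) (hn0 : (0 : ℝ) < n) (hp : ∀ i, b ≤ p i)
    (hsq : ∑ i, p i ^ 2 ≤ n * l)
    (hexc : θ * (1 + 2 * η) * ∑ i, p i ≤ ∑ i, (1 - Real.exp (-(θ * p i))) * p i) :
    ExpandingWeights p θ η (2 * m) := by
  have hp0 : ∀ i, 0 < p i := fun i => hb.trans_le (hp i)
  have hvol_ge := mul_card_le_sum hp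
  have hvol0 : 0 < ∑ i, p i := (by positivity : 0 < b * n).trans_le hvol_ge
  have hr0 : 0 < r := by
    by_contra h
    have : 0 < l ^ 2 := by positivity
    nlinarith
  refine ⟨hθ, hθ1, hη, hη1, hexc, fun S hS => ?_⟩
  have hS0 : 0 ≤ ∑ z ∈ S, p z := Finset.sum_nonneg fun z _ => (hp0 z).le
  -- Cauchy–Schwarz: a set of 2m vertices weighs at most √(2mnl), which is of smaller order than n/l
  -- since m = √n l². The extra factor l pays for the ratio of the second moment to the volume.
  have hcs : (∑ z ∈ S, p z) ^ 2 ≤ 2 * m * (n * l) := by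
    refine (sq_sum_le_card_mul_sum_sq).trans ?_
    have h1 : ∑ z ∈ S, p z ^ 2 ≤ ∑ z, p z ^ 2 :=
      Finset.sum_le_sum_of_subset_of_nonneg (Finset.subset_univ _) fun z _ _ => sq_nonneg _
    have h2 : 0 ≤ ∑ z ∈ S, p z ^ 2 := Finset.sum_nonneg fun i _ => sq_nonneg _
    have h3 : 0 ≤ 2 * m := by linarith
    exact mul_le_mul hS (h1.trans hsq) h2 h3
  have hsl : (∑ z ∈ S, p z) * l ≤ α * n := by
    refine le_of_pow_le_pow_left₀ two_ne_zero (by positivity) ?_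
    calc ((∑ z ∈ S, p z) * l) ^ 2 = (∑ z ∈ S, p z) ^ 2 * l ^ 2 := by ring
      _ ≤ 2 * m * (n * l) * l ^ 2 := mul_le_mul_of_nonneg_right hcs (sq_nonneg _)
      _ = 2 * l ^ 5 * (r * n) := by rw [hm]; ring
      _ ≤ α ^ 2 * r * (r * n) := mul_le_mul_of_nonneg_right hB2 (by positivity)
      _ = α ^ 2 * (r * r) * n := by ring
      _ = (α * n) ^ 2 := by rw [hrr]; ring
  have hfrac : (∑ z, p z ^ 2) / (2 * ∑ z, p z) ≤ l / (2 * b) := by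
    rw [div_le_div_iff₀ (by positivity) (by positivity)]
    nlinarith
  have h1 : (∑ z ∈ S, p z) * (∑ z, p z ^ 2) / (2 * ∑ z, p z) ≤
      (∑ z ∈ S, p z) * l * (1 / (2 * b)) := by
    rw [mul_div_assoc]
    refine (mul_le_mul_of_nonneg_left hfrac hS0).trans (le_of_eq ?_)
    ring
  have h2 : ∑ z ∈ S, p z ≤ (∑ z ∈ S, p z) * l := le_mul_of_one_le_right hS0 hl1
  have h3 : 0 < 1 + 1 / (2 * b) := by positivity
  have h4 : α * (1 + 1 / (2 * b)) = θ * η * b := by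
    rw [hα]; field_simp
  calc _ ≤ (∑ z ∈ S, p z) * l * (1 + 1 / (2 * b)) := by linarith
    _ ≤ α * n * (1 + 1 / (2 * b)) := mul_le_mul_of_nonneg_right hsl h3.le
    _ = θ * η * (b * n) := by linear_combination n * h4
    _ ≤ _ := mul_le_mul_of_nonneg_left hvol_ge (by positivity)

theorem sum_edgeProb_ge {n : ℕ} {p : Fin n → ℝ} {b ν : ℝ} (hb : 0 < b) (hν1 : 1 < ν) (hn1 : 1 < n)
    (hp : ∀ i, b ≤ p i) (hvol : ∑ i, p i ≤ 5 / 4 * ν * n) (hsq : ∑ i, p i ^ 2 ≤ n * Real.log n)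
    (z : Fin n) :
    2 * b / (5 * ν) * p z ≤ ∑ y ∈ Finset.univ.erase z, edgeProb p s(z, y) := by
  have hn0 : (0 : ℝ) < n := by exact_mod_cast (by omega : 0 < n)
  have hp0 : ∀ i, 0 < p i := fun i => hb.trans_le (hp i)
  have hvol_ge := mul_card_le_sum hp
  have hvol0 : 0 < ∑ i, p i := (by positivity : 0 < b * n).trans_le hvol_ge
  -- This keeps p z · b / vol at most 1, so the truncation in the edge probability does not spoil
  -- the lower bound.
  have hpz : p z ≤ n := by
    have h1 : p z ^ 2 ≤ ∑ i, p i ^ 2 :=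
      Finset.single_le_sum (f := fun i => p i ^ 2) (fun i _ => sq_nonneg _) (Finset.mem_univ z)
    have h2 : Real.log n ≤ n := by
      have := Real.log_le_sub_one_of_pos hn0
      linarith
    refine le_of_pow_le_pow_left₀ two_ne_zero hn0.le ?_
    nlinarith
  have hterm : ∀ y ∈ Finset.univ.erase z, p z * b / ∑ i, p i ≤ edgeProb p s(z, y) := fun y _ => by
    refine le_min ?_ ?_
    · have := (hp0 z).le
      gcongr
      exact hp y
    · rw [div_le_one hvol0]; nlinarith
  have hs := Finset.card_nsmul_le_sum _ _ _ hterm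
  rw [Finset.card_erase_of_mem (Finset.mem_univ z), Finset.card_univ, Fintype.card_fin,
    nsmul_eq_mul, Nat.cast_sub hn1.le, Nat.cast_one] at hs
  refine le_trans ?_ hs
  have hnn : (n : ℝ) ≤ 2 * (n - 1) := by
    have : (2 : ℝ) ≤ n := by exact_mod_cast hn1
    linarith
  rw [div_mul_eq_mul_div, mul_div_assoc', div_le_div_iff₀ (by positivity) hvol0]
  have h1 : 0 < 2 * b * p z := by have := hp0 z; positivity
  have h2 : 2 * b * p z * ∑ i, p i ≤ 2 * b * p z * (5 / 4 * ν * n) :=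
    mul_le_mul_of_nonneg_left hvol h1.le
  have h3 : 2 * b * p z * (5 / 4 * ν) * n ≤ 2 * b * p z * (5 / 4 * ν) * (2 * (n - 1)) :=
    mul_le_mul_of_nonneg_left hnn (by positivity)
  linarith

/-- The estimate for a large number of vertices with typical weights. -/
theorem exists_bound_of_typical_weights {b θ η ν : ℝ} (hb : 0 < b) (hν1 : 1 < ν) (hθ : 0 < θ)
    (hθ1 : θ ≤ 1 / 10) (hη : 0 < η) (hη1 : η ≤ 1) :
    ∃ C : ℝ, 0 < C ∧ ∀ᶠ n : ℕ in atTop, ∀ p : Fin n → ℝ, (∀ i, b ≤ p i) →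
      ∑ i, p i ≤ 5 / 4 * ν * n → ∑ i, p i ^ 2 ≤ n * Real.log n →
      θ * (1 + 2 * η) * ∑ i, p i ≤ ∑ i, (1 - Real.exp (-(θ * p i))) * p i →
      (edgeMeasure p).real {c | ¬ HasGoodLabels (configGraph c) (5 * √(ν * Real.log n) * √(n : ℝ))
        (C * √(n : ℝ) * Real.log n ^ 2)} ≤ 11 / n := by
  set κ := 2 * b / (5 * ν) with hκ
  have hκ0 : 0 < κ := by positivity
  set D := 16 / (κ * b) + 5 + 80 / κ with hD
  have hD0 : 0 < D := by positivity
  set α := θ * η * b / (1 + 1 / (2 * b)) with hα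
  have hα0 : 0 < α := by positivity
  have hsν : 1 ≤ √ν := Real.one_le_sqrt.2 hν1.le
  -- The 2 comes from the ball bound 2m; the rest from t ≤ 5√ν √n log n times D log n neighbors per
  -- vertex of the last layer.
  refine ⟨2 + 5 * √ν * D, by positivity, ?_⟩
  -- The bound on log n yields t ≤ m and t + L ≤ θηbm. The bound on √n yields L ≤ t/50 through the
  -- 50 and the smallness of sets of 2m vertices through 2/α².
  filter_upwards [eventually_log_bounds (1 + 5 * √ν + (5 * √ν + 5) / (θ * η * b)) (50 + 2 / α ^ 2),
    eventually_gt_atTop 1] with n hn hn1 p hp hvol hsq hexc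
  obtain ⟨hA, hB⟩ := hn
  set l := Real.log n with hl
  set r := √(n : ℝ) with hr
  have hn1' : (1 : ℝ) < n := by exact_mod_cast hn1
  have hn0 : (0 : ℝ) < n := by linarith
  have hrr : r * r = n := Real.mul_self_sqrt hn0.le
  have hr1 : 1 ≤ r := Real.one_le_sqrt.2 hn1'.le
  have hq : 0 ≤ (5 * √ν + 5) / (θ * η * b) := by positivity
  have hl1 : 1 ≤ l := by linarith
  have hl5 : l ≤ l ^ 5 := le_self_pow₀ hl1 (by norm_num)
  have hB1 : 50 * l ≤ r := by
    have : 0 ≤ 2 / α ^ 2 * l ^ 5 := by positivity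
    nlinarith
  have hB2 : 2 * l ^ 5 ≤ α ^ 2 * r := by
    have h1 : 2 / α ^ 2 * l ^ 5 ≤ r := by
      have : 0 ≤ 50 * l ^ 5 := by positivity
      linarith
    rwa [div_mul_eq_mul_div, div_le_iff₀ (by positivity), mul_comm r] at h1
  have hA3 : 5 * √ν + 5 ≤ θ * η * b * l := by
    have h1 : (5 * √ν + 5) / (θ * η * b) ≤ l := by linarith
    rwa [div_le_iff₀ (by positivity), mul_comm l] at h1
  set t := 5 * √(ν * l) * r with ht
  set m := r * l ^ 2 with hm
  have hsq_t : t ^ 2 = 25 * ν * l * n := by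
    rw [ht, mul_pow, mul_pow, Real.sq_sqrt (by positivity), sq r, hrr]; ring
  have hsl : √(ν * l) ≤ √ν * l := by
    rw [Real.sqrt_mul (by linarith)]
    refine mul_le_mul_of_nonneg_left ?_ (Real.sqrt_nonneg _)
    exact Real.sqrt_le_iff.2 ⟨by linarith, le_self_pow₀ hl1 two_ne_zero⟩
  have hsl1 : 1 ≤ √(ν * l) := Real.one_le_sqrt.2 (one_le_mul_of_one_le_of_one_le hν1.le hl1)
  have ht_le : t ≤ 5 * √ν * l * r := by
    have := mul_le_mul_of_nonneg_right hsl (by linarith : 0 ≤ r)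
    rw [ht]; linarith
  have hr5 : 5 * r ≤ t := by
    have := mul_le_mul_of_nonneg_right hsl1 (by linarith : 0 ≤ r)
    rw [ht]; linarith
  have hlr : 0 ≤ l * r := by positivity
  have htm : t ≤ m := by
    have h1 : 5 * √ν * (l * r) ≤ l * (l * r) :=
      mul_le_mul_of_nonneg_right (by linarith) hlr
    rw [hm]; linarith
  have hm1 : 1 < m := by linarith
  have hp0 : ∀ i, 0 < p i := fun i => hb.trans_le (hp i)
  have hvol_ge := mul_card_le_sum hp
  have hvol0 : 0 < ∑ i, p i := (by positivity : 0 < b * n).trans_le hvol_ge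
  have hW : ExpandingWeights p θ η (2 * m) :=
    expandingWeights_of_typical hb hθ hθ1 hη hη1 hl1 hrr hα hα0 hB2 hm hm1 hn0 hp hsq hexc
  have hdeg : ∀ z, κ * p z ≤ ∑ y ∈ Finset.univ.erase z, edgeProb p s(z, y) := fun z => by
    have := sum_edgeProb_ge hb hν1 hn1 hp hvol hsq z
    rwa [hκ]
  have hμ : 8 * (∑ y, p y ^ 2) / (κ * ∑ y, p y) ≤ 8 * l / (κ * b) := by
    rw [div_le_div_iff₀ (by positivity) (by positivity)]
    have h1 : (∑ y, p y ^ 2) * b ≤ l * ∑ y, p y := by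
      have h2 := mul_le_mul_of_nonneg_right hsq hb.le
      have h3 := mul_le_mul_of_nonneg_left hvol_ge (by linarith : 0 ≤ l)
      linarith
    have h2 := mul_le_mul_of_nonneg_left h1 (by positivity : 0 ≤ 8 * κ)
    linarith
  -- With L = 5 log n the factor e^{-L} = n⁻⁵ beats the n⁴ events.
  have main := hW.prob_not_hasGoodLabels_le (L := 5 * l) hb hp (by linarith : 1 ≤ t) htm hm1 hκ0 hdeg
    hμ (by linarith) (by
      rw [le_div_iff₀ hvol0, mul_pow, hsq_t]
      have h1 := mul_le_mul_of_nonneg_left hvol (by linarith : 0 ≤ 5 * l)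
      have h2 := mul_pos (mul_pos (by linarith : 0 < ν) (by linarith : 0 < l)) hn0
      linarith) (by linarith) (by
      have h1 : 5 * l ≤ 5 * l * r := le_mul_of_one_le_right (by linarith) hr1
      have h2 := mul_le_mul_of_nonneg_right hA3 hlr
      rw [hm]
      linarith)
  have hR : 2 * m + t * (2 * (8 * l / (κ * b)) + 5 * l + 16 * (5 * l) / κ) ≤
      (2 + 5 * √ν * D) * r * l ^ 2 := by
    have e : 2 * (8 * l / (κ * b)) + 5 * l + 16 * (5 * l) / κ = D * l := by rw [hD]; ring
    rw [e]
    have h1 : t * (D * l) ≤ 5 * √ν * l * r * (D * l) :=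
      mul_le_mul_of_nonneg_right ht_le (by positivity)
    rw [hm]
    linarith
  have hsub : {c : Sym2 (Fin n) → Bool | ¬ HasGoodLabels (configGraph c) t
      ((2 + 5 * √ν * D) * r * l ^ 2)} ⊆ {c | ¬ HasGoodLabels (configGraph c) t
      (2 * m + t * (2 * (8 * l / (κ * b)) + 5 * l + 16 * (5 * l) / κ))} :=
    fun c hc hgood => hc (hgood.mono hR)
  refine (measureReal_mono hsub).trans (main.trans (le_of_eq ?_))
  have e : Real.exp (-(5 * l)) = ((n : ℝ) ^ 5)⁻¹ := by
    rw [Real.exp_neg, show (5 : ℝ) * l = (5 : ℕ) * l by norm_num, Real.exp_nat_mul,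
      Real.exp_log hn0]
  rw [e, Fintype.card_fin]
  field_simp

end Asymptotics

/-! ### The random power law graph -/

section RandomGraph

/-- The states of the pairs in a sample. -/
noncomputable def sampleConfig {n : ℕ} (ω : PowerLawSample n) : Sym2 (Fin n) → Bool :=
  fun e => decide ((ω.2 e : ℝ) < edgeProb ω.1 e)

theorem configGraph_sampleConfig {n : ℕ} (ω : PowerLawSample n) :
    configGraph (sampleConfig ω) = powerLawGraph ω := by
  ext x y
  show (x ≠ y ∧ decide ((ω.2 s(x, y) : ℝ) < edgeProb ω.1 s(x, y)) = true) ↔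
    (x ≠ y ∧ (ω.2 s(x, y) : ℝ) < chungLuProb ω.1 x y)
  rw [decide_eq_true_iff, edgeProb_mk]

theorem measurable_edgeProb {n : ℕ} (e : Sym2 (Fin n)) :
    Measurable fun p : Fin n → ℝ => edgeProb p e := by
  induction e using Sym2.inductionOn with
  | hf x y =>
    simp only [edgeProb_mk, chungLuProb]
    fun_prop

theorem measurable_sampleConfig (n : ℕ) :
    Measurable (sampleConfig : PowerLawSample n → Sym2 (Fin n) → Bool) := by
  refine measurable_pi_lambda _ fun e => measurable_to_bool ?_
  have : (fun ω : PowerLawSample n => sampleConfig ω e) ⁻¹' {true} =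
      {ω | (ω.2 e : ℝ) < edgeProb ω.1 e} := by
    ext ω; simp [sampleConfig]
  rw [this]
  exact measurableSet_lt (by fun_prop) ((measurable_edgeProb e).comp measurable_fst)

theorem map_sampleConfig {n : ℕ} (p : Fin n → ℝ) (S : Set (Sym2 (Fin n) → Bool)) :
    (Measure.pi fun _ : Sym2 (Fin n) => (volume : Measure unitInterval))
      {U | sampleConfig (p, U) ∈ S} = edgeMeasure p S := by
  have h := Measure.pi_map_pi (μ := fun _ : Sym2 (Fin n) => (volume : Measure unitInterval))
    (f := fun e (u : unitInterval) => decide ((u : ℝ) < edgeProb p e))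
    (hμ := fun e => by
      have : IsProbabilityMeasure ((volume : Measure unitInterval).map
          fun u : unitInterval => decide ((u : ℝ) < edgeProb p e)) :=
        Measure.isProbabilityMeasure_map (measurable_edgeState p e).aemeasurable
      infer_instance)
    fun e => (measurable_edgeState p e).aemeasurable
  have h2 : edgeMeasure p = Measure.pi fun e : Sym2 (Fin n) =>
      (volume : Measure unitInterval).map fun u : unitInterval => decide ((u : ℝ) < edgeProb p e) := rfl
  have hm : Measurable fun (U : Sym2 (Fin n) → unitInterval) (e : Sym2 (Fin n)) =>
      decide ((U e : ℝ) < edgeProb p e) := measurable_pi_lambda _ fun e =>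
    (measurable_edgeState p e).comp (measurable_pi_apply e)
  rw [h2, ← h, Measure.map_apply hm (Set.toFinite S).measurableSet]
  rfl

/-- A graph event is at most as likely as atypical weights plus its worst probability for typical
weights. -/
theorem powerLawSampleMeasure_le {n : ℕ} {xmin β : ℝ} [IsProbabilityMeasure (powerLaw xmin β)]
    (S : Set (Sym2 (Fin n) → Bool)) (A : Set (Fin n → ℝ)) {e : ℝ}
    (h : ∀ p ∉ A, (edgeMeasure p).real S ≤ e) :
    powerLawSampleMeasure n xmin β {ω | sampleConfig ω ∈ S} ≤
      Measure.pi (fun _ : Fin n => powerLaw xmin β) A + ENNReal.ofReal e := by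
  have hS : MeasurableSet {ω : PowerLawSample n | sampleConfig ω ∈ S} :=
    measurable_sampleConfig n (Set.toFinite S).measurableSet
  set P := Measure.pi (fun _ : Fin n => powerLaw xmin β)
  rw [powerLawSampleMeasure, Measure.prod_apply hS]
  calc ∫⁻ p, (Measure.pi fun _ : Sym2 (Fin n) => (volume : Measure unitInterval))
        (Prod.mk p ⁻¹' {ω : PowerLawSample n | sampleConfig ω ∈ S}) ∂P
      -- A measurable hull of the same measure replaces A, which need not be measurable.
      ≤ ∫⁻ p, ((toMeasurable P A).indicator 1 p + ENNReal.ofReal e) ∂P := by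
        refine lintegral_mono fun p => ?_
        have e1 : (Measure.pi fun _ : Sym2 (Fin n) => (volume : Measure unitInterval))
          (Prod.mk p ⁻¹' {ω : PowerLawSample n | sampleConfig ω ∈ S}) = edgeMeasure p S :=
          map_sampleConfig p S
        simp only
        rw [e1]
        by_cases hp : p ∈ A
        · rw [Set.indicator_of_mem (subset_toMeasurable P A hp)]
          exact prob_le_one.trans le_self_add
        · refine le_trans ?_ le_add_self
          rw [← ofReal_measureReal]
          exact ENNReal.ofReal_le_ofReal (h p hp)
    _ = P A + ENNReal.ofReal e := by
        rw [lintegral_add_right _ measurable_const, lintegral_indicator_one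
          (measurableSet_toMeasurable P A), measure_toMeasurable, lintegral_const]
        simp

theorem pi_not_forall_ge_eq_zero {μ : Measure ℝ} [IsProbabilityMeasure μ] {b : ℝ}
    (h : ∀ᵐ x ∂μ, b ≤ x) (n : ℕ) :
    Measure.pi (fun _ : Fin n => μ) {p | ¬ ∀ i, b ≤ p i} = 0 := by
  have : ∀ᵐ p ∂(Measure.pi fun _ : Fin n => μ), ∀ i, b ≤ p i :=
    ae_all_iff.2 fun i => (measurePreserving_eval (fun _ : Fin n => μ) i).quasiMeasurePreserving.ae h
  exact this

/-- Subadditivity suffices, so the events need not be measurable. -/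
theorem tendsto_measure_one_of_compl {Ω : ℕ → Type*} [∀ n, MeasurableSpace (Ω n)]
    (μ : ∀ n, Measure (Ω n)) [∀ n, IsProbabilityMeasure (μ n)] (S : ∀ n, Set (Ω n))
    (h : Tendsto (fun n => μ n (S n)ᶜ) atTop (𝓝 0)) : Tendsto (fun n => μ n (S n)) atTop (𝓝 1) := by
  have h1 : Tendsto (fun n => 1 - μ n (S n)ᶜ) atTop (𝓝 1) := by
    have := ENNReal.Tendsto.sub (tendsto_const_nhds (x := (1 : ENNReal)) (f := atTop)) h
      (Or.inl ENNReal.one_ne_top)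
    simpa using this
  refine tendsto_of_tendsto_of_tendsto_of_le_of_le h1 tendsto_const_nhds (fun n => ?_)
    fun n => prob_le_one
  have h2 := measure_univ_le_add_compl (μ := μ n) (S n)
  rw [measure_univ] at h2
  exact tsub_le_iff_right.2 h2

end RandomGraph

theorem mainTheorem6 (β xmin ν : ℝ) (hβ : 3 < β) (hxmin : 0 < xmin)
    (hν : ∫ x, x ∂(powerLaw xmin β) = ν) (hν1 : 1 < ν) :
    ∃ C : ℝ, 0 < C ∧
      Tendsto
        (fun n : ℕ => powerLawSampleMeasure n xmin β
          {ω | ∀ π : Fin n ≃ Fin n,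
            let G := powerLawGraph ω
            let δ : ℝ := 5 * √(ν * Real.log n)
            let L := approximatePruning G π 0 (localRadius G (δ * √(n : ℝ)))
            L.IsTwoHopCover G ∧
              ∀ x : Fin n, ((L.landmarks x).ncard : ℝ) ≤ C * √(n : ℝ) * Real.log n ^ 2})
        atTop (𝓝 1) := by
  have hprob := isProbabilityMeasure_powerLaw hxmin hβ
  have hae := ae_le_powerLaw xmin β
  have h2 := memLp_two_powerLaw hxmin hβ
  obtain ⟨θ, η, hθ, hθ1, hη, hη1, hexc⟩ := exists_exponential_excess hxmin hae h2 hν hν1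
  obtain ⟨C, hC, hbound⟩ := exists_bound_of_typical_weights hxmin hν1 hθ hθ1 hη hη1
  refine ⟨C, hC, ?_⟩
  set μ := powerLaw xmin β with hμ
  -- The function is bounded by a constant times x, so Chebyshev needs only the second moment of the
  -- weights.
  have hF : MemLp (fun x : ℝ => (1 - Real.exp (-(θ * x))) * x - θ * (1 + 2 * η) * x) 2 μ := by
    refine (h2.const_mul (1 + θ * (1 + 2 * η))).mono
      (by fun_prop : Measurable fun x : ℝ =>
        (1 - Real.exp (-(θ * x))) * x - θ * (1 + 2 * η) * x).aestronglyMeasurable ?_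
    filter_upwards [hae] with x hx
    have hx0 : 0 < x := hxmin.trans_le hx
    have e1 : Real.exp (-(θ * x)) ≤ 1 := by simpa using (mul_pos hθ hx0).le
    have e2 := Real.exp_pos (-(θ * x))
    have e3 : 0 < θ * (1 + 2 * η) * x := by positivity
    have e4 : (1 - Real.exp (-(θ * x))) * x ≤ x := mul_le_of_le_one_left hx0.le (by linarith)
    have e5 : 0 ≤ (1 - Real.exp (-(θ * x))) * x := mul_nonneg (by linarith) hx0.le
    rw [Real.norm_eq_abs, Real.norm_eq_abs, abs_of_nonneg (by positivity : 0 ≤ (1 + θ * (1 + 2 * η)) * x)]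
    exact abs_le.2 ⟨by linarith, by linarith⟩
  have t1 := tendsto_pi_sum_le hF hexc
  have t2 := tendsto_pi_sum_le (μ := μ) (F := fun x => -x) h2.neg (a := -(5 / 4 * ν)) (by
    rw [integral_neg, hν]; linarith)
  -- Fourth moments may be infinite, so Chebyshev is unavailable for the squares; Markov with a
  -- spare log n is enough.
  have t3 := tendsto_pi_sum_gt_log (μ := μ) (F := fun x => x ^ 2) h2.integrable_sq
    fun x => sq_nonneg x
  have t4 : Tendsto (fun n : ℕ => ENNReal.ofReal (11 / n)) atTop (𝓝 0) := by
    simpa using ENNReal.tendsto_ofReal (tendsto_const_div_atTop_nhds_zero_nat (11 : ℝ))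
  have hpm : ∀ n, IsProbabilityMeasure (powerLawSampleMeasure n xmin β) := fun n => by
    unfold powerLawSampleMeasure
    infer_instance
  refine tendsto_measure_one_of_compl _ _ ?_
  have hlim := ((t1.add t2).add t3).add t4
  simp only [add_zero] at hlim
  refine tendsto_of_tendsto_of_tendsto_of_le_of_le' tendsto_const_nhds hlim
    (Eventually.of_forall fun _ => zero_le) ?_
  filter_upwards [hbound] with n hn
  let P := Measure.pi (fun _ : Fin n => μ)
  let A1 : Set (Fin n → ℝ) :=
    {p | ∑ i, ((1 - Real.exp (-(θ * p i))) * p i - θ * (1 + 2 * η) * p i) ≤ 0 * n}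
  let A2 : Set (Fin n → ℝ) := {p | ∑ i, -p i ≤ -(5 / 4 * ν) * n}
  let A3 : Set (Fin n → ℝ) := {p | n * Real.log n < ∑ i, p i ^ 2}
  let A4 : Set (Fin n → ℝ) := {p | ¬ ∀ i, xmin ≤ p i}
  have hA : P (A1 ∪ A2 ∪ A3 ∪ A4) ≤ P A1 + P A2 + P A3 := by
    refine (measure_union_le _ _).trans ?_
    rw [show P A4 = 0 from pi_not_forall_ge_eq_zero hae n, add_zero]
    exact (measure_union_le _ _).trans (add_le_add_left (measure_union_le _ _) _)
  have hmain := powerLawSampleMeasure_le (xmin := xmin) (β := β)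
    {c : Sym2 (Fin n) → Bool | ¬ HasGoodLabels (configGraph c) (5 * √(ν * Real.log n) * √(n : ℝ))
      (C * √(n : ℝ) * Real.log n ^ 2)} (A1 ∪ A2 ∪ A3 ∪ A4) (e := 11 / n) fun p hp => by
    simp only [Set.mem_union, not_or] at hp
    obtain ⟨⟨⟨p1, p2⟩, p3⟩, p4⟩ := hp
    have q1 : ¬ (∑ i, ((1 - Real.exp (-(θ * p i))) * p i - θ * (1 + 2 * η) * p i) ≤ 0 * n) := p1
    have q2 : ¬ (∑ i, -p i ≤ -(5 / 4 * ν) * n) := p2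
    have q3 : ¬ (n * Real.log n < ∑ i, p i ^ 2) := p3
    rw [Finset.sum_sub_distrib, ← Finset.mul_sum] at q1
    rw [Finset.sum_neg_distrib] at q2
    exact hn p (not_not.1 p4) (by linarith) (not_lt.1 q3) (by linarith)
  refine (measure_mono (t := {ω | sampleConfig ω ∈ _}) fun ω hω => ?_).trans
    (hmain.trans (add_le_add_left hA _))
  by_contra hgood
  -- Goodness of the labels does not involve the ordering, so one event serves all orderings at
  -- once.
  refine hω fun π => ?_
  have hg : HasGoodLabels (powerLawGraph ω) (5 * √(ν * Real.log n) * √(n : ℝ))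
      (C * √(n : ℝ) * Real.log n ^ 2) := by
    rw [← configGraph_sampleConfig]
    exact not_not.1 hgood
  refine ⟨isTwoHopCover_of_edist_le _ π _ hg.1, fun x => ?_⟩
  rw [landmarks_approximatePruning_zero]
  exact hg.2 x
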